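/- \textbf{Theorem (Consistency and support recovery).} Let $d\ge 0$ be fixed, write $\operatorname{supp}(w)=\{i: w_i\neq 0\}$ for $w\in\mathbb R^d$, and let $|\cdot|$, powers and $\circ$ act entrywise. Let $\Phi:\mathbb R^d\to[0,+\infty]$ be proper, convex, normalized ($\Phi(0)=0$), absolute ($\Phi(w)=\Phi(|w|)$) and monotone ($|w|\ge|w'|$ entrywise implies $\Phi(w)\ge\Phi(w')$). A set $J\subseteq\{1,\dots,d\}$ is called \emph{strongly stable} w.r.t. $\Phi$ if for every $w$ with $\operatorname{supp}(w)\subseteq J$ there are $M>0$ and a neighbourhood $U$ of $w$ such that $$\Phi(w'+\Delta)\ \ge\ \Phi(w')+M\|\Delta\|_\infty\qquad\text{for all } w'\in U,\ \operatorname{supp}(w')\subseteq J,\ \text{ and all }\Delta\in\mathbb R^d,\ \operatorname{supp}(\Delta)\subseteq J^c .$$ (This holds in particular if one constant $M_J>0$ serves all $w$ with $\operatorname{supp}(w)\subseteq J$.) For each $n$ let $y=X_nw^*+\epsilon$ be a linear model with $w^*\in\mathbb R^d$, a fixed design $X_n\in\mathbb R^{n\times d}$ and $\epsilon=(\epsilon_1,\dots,\epsilon_n)$,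 where $\epsilon_1,\epsilon_2,\dots$ are i.i.d. real random variables with mean $0$ and finite variance $\sigma^2$. Assume that $\frac1nX_n^\top X_n\to Q$ with $Q\succ0$ (for instance $\frac1nX_n^\top X_n=Q$ for all large $n$), and that $\max_{i,j}|(X_n)_{ij}|/\sqrt n\to0$ (which is automatic if $X_n$ consists of the first $n$ rows of one infinite array). Let $0<\alpha<1$, let $w^0=w^0_n$ be random vectors with $\sqrt n\,(w^0_n-w^*)$ bounded in probability, and let $\lambda_n>0$. Let $\hat w=\hat w_n$ be random vectors such that, almost surely, $\hat w_n$ is a minimizer of $$\min_{w\in\mathbb R^d}\ \tfrac12\|y-X_nw\|_2^2+\lambda_n\,\Phi\big(|w^0|^{\alpha-1}\circ|w|\big)$$ whenever a minimizer exists; where $w^0_i=0$ the weight is $+\infty$, that is, the second term is $+\infty$ if $w_i\ne0$ for some such $i$, and for $w_i=0$ the product $|w^0_i|^{\alpha-1}|w_i|$ is read as $0$. Let $J=\operatorname{supp}(w^*)$ be strongly stable w.r.t. $\Phi$, let $|w^*|^\alpha$ lie in the interior of $\{w:\Phi(w)<+\infty\}$, and suppose that $$\frac{\lambda_n}{\sqrt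 n}\to0,\qquad \frac{\lambda_n}{n^{\alpha/2}}\to\infty .$$ Then $\hat w$ is consistent, $\hat w\xrightarrow{p}w^*$; it is asymptotically normal on $J$, $$\sqrt n\,(\hat w_J-w^*_J)\ \xrightarrow{d}\ \mathcal N\big(0,\sigma^2Q_{JJ}^{-1}\big),$$ where vectors are restricted to the coordinates in $J$ and $Q_{JJ}$ is the corresponding principal submatrix of $Q$; and it recovers the support, $P(\operatorname{supp}(\hat w)=J)\to1$. -/

import Mathlib

open MeasureTheory ProbabilityTheory Filter Topology
open scoped ENNReal NNReal

namespace AdaptiveEstimation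

/-- The support `{i : w i ≠ 0}` of a vector. -/
noncomputable def supp {d : ℕ} (w : Fin d → ℝ) : Finset (Fin d) :=
  Finset.univ.filter fun i => w i ≠ 0

/-- A proper normalized absolute monotone convex function `Φ : ℝ^d → [0, +∞]`.
Properness (`Φ` is not identically `+∞`) is contained in the normalization `Φ 0 = 0`.
Convexity is the usual inequality in `[0, +∞]`; its coefficients are nonnegative reals. -/
structure IsMonotonePenalty {d : ℕ} (Φ : (Fin d → ℝ) → ℝ≥0∞) : Prop where
  normalized : Φ 0 = 0
  convex : ConvexOn ℝ≥0 Set.univ Φ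
  absolute : ∀ w, Φ w = Φ |w|
  monotone : ∀ w w', |w'| ≤ |w| → Φ w' ≤ Φ w

/-- The effective domain `{w : Φ w < +∞}`. -/
def effDom {d : ℕ} (Φ : (Fin d → ℝ) → ℝ≥0∞) : Set (Fin d → ℝ) :=
  {w | Φ w < ∞}

/-- `Φ` is decomposable at `w` with respect to `J`, with constant `M`:
`Φ (w + Δ) ≥ Φ w + M ‖Δ‖_∞` for every `Δ` supported in the complement of `J`.
The norm of `Fin d → ℝ` is the sup norm. -/
def DecomposableWith {d : ℕ} (Φ : (Fin d → ℝ) → ℝ≥0∞) (J : Finset (Fin d)) (M : ℝ)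
    (w : Fin d → ℝ) : Prop :=
  ∀ Δ : Fin d → ℝ, supp Δ ⊆ Jᶜ → Φ w + ENNReal.ofReal (M * ‖Δ‖) ≤ Φ (w + Δ)

/-- `J` is strongly stable with respect to `Φ`: at every `w` with support in `J`, `Φ` is
decomposable with respect to `J`, with a positive constant that serves all points supported in `J`
close to `w` (so in particular `w` itself). One constant for all `w` supported in `J` is a
special case. -/
def StronglyStable {d : ℕ} (Φ : (Fin d → ℝ) → ℝ≥0∞) (J : Finset (Fin d)) : Prop :=
  ∀ w : Fin d → ℝ, supp w ⊆ J →
    ∃ M : ℝ, 0 < M ∧ ∀ᶠ w' in 𝓝 w, supp w' ⊆ J → DecomposableWith Φ J M w'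

open Classical in
/-- The adaptive penalty `Φ (|w⁰|^(α-1) ∘ |w|)`, for `α < 1`. A vanishing coordinate of `w⁰` stands
for the weight `+∞`, which forces the same coordinate of `w` to vanish (with `(+∞) * 0 = 0`). -/
noncomputable def adaptivePenalty {d : ℕ} (Φ : (Fin d → ℝ) → ℝ≥0∞) (α : ℝ) (w0 w : Fin d → ℝ) :
    ℝ≥0∞ :=
  if ∃ i, w0 i = 0 ∧ w i ≠ 0 then ∞ else Φ fun i => |w0 i| ^ (α - 1) * |w i|

/-- The objective `½ ‖y - X w‖₂² + lam * Φ (|w⁰|^(α-1) ∘ |w|)` of the one-step adaptive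
estimator. -/
noncomputable def objective {n d : ℕ} (X : Matrix (Fin n) (Fin d) ℝ) (y : Fin n → ℝ) (lam : ℝ)
    (Φ : (Fin d → ℝ) → ℝ≥0∞) (α : ℝ) (w0 w : Fin d → ℝ) : ℝ≥0∞ :=
  ENNReal.ofReal (1 / 2 * ∑ i, (y i - X.mulVec w i) ^ 2) +
    ENNReal.ofReal lam * adaptivePenalty Φ α w0 w

/-- `w` minimizes the objective of the one-step adaptive estimator over `ℝ^d`. -/
def IsAdaptiveEstimate {n d : ℕ} (X : Matrix (Fin n) (Fin d) ℝ) (y : Fin n → ℝ) (lam : ℝ)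
    (Φ : (Fin d → ℝ) → ℝ≥0∞) (α : ℝ) (w0 w : Fin d → ℝ) : Prop :=
  IsMinOn (objective X y lam Φ α w0) Set.univ w

/-- The response `y = X w + ε` of the linear model with `n` observations. -/
def response {n d : ℕ} (X : Matrix (Fin n) (Fin d) ℝ) (w : Fin d → ℝ) (ε : ℕ → ℝ) : Fin n → ℝ :=
  fun i => X.mulVec w i + ε i

/-- `√n`-consistency of the estimators `w0 n` of `w`: `√n (w0 n - w)` is bounded in probability. -/
def SqrtConsistent {Ω : Type*} [MeasurableSpace Ω] {d : ℕ} (μ : Measure Ω)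
    (w0 : ℕ → Ω → Fin d → ℝ) (w : Fin d → ℝ) : Prop :=
  ∀ δ : ℝ, 0 < δ → ∃ K : ℝ, ∀ᶠ n : ℕ in atTop,
    μ {ω | K < √n * ‖w0 n ω - w‖} ≤ ENNReal.ofReal δ

end AdaptiveEstimation

/-!
Write `J` for the support of `wstar`, `v = √n (w - wstar)` for the local parameter,
`S = n⁻¹ Xᵀ X` for the empirical Gram matrix and `z = n^(-1/2) Xᵀ ε` for the normalized score. Up to
a constant the least squares loss is `½ vᵀ S v - zᵀ v` (`half_sum_sq_residual_eq`), and `S` is close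
to `Q`. The claim is that, with probability tending to one, minimizers of the objective exist, are
supported exactly on `J`, and have a local parameter close to `Q_JJ⁻¹ z_J`, the least squares
solution on `J`.

This is first proved for each realization with `‖z‖` and `√n ‖w0 - wstar‖` bounded by a constant
(`eventually_isAdaptiveEstimate_near`). On the coordinate subspace of `J` the adaptive penalty is
Lipschitz near `wstar`, because `|wstar|^α` is interior to the domain of `Φ`; over local parameters
in a bounded set it varies by `O(lam / √n) = o(1)`, so there the objective is governed by its
quadratic part and is larger on a small sphere around `Q_JJ⁻¹ z_J` than at the centre
(`quadLoss_growth`). Off `J`, the weights are at least of order `n^((1-α)/2)`, and strong stability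
makes the penalty grow at rate `lam n^((1-α)/2) = √n (lam / n^(α/2))` in the coordinates outside
`J`, which outweighs the slope of the loss, of order `√n`; setting these coordinates to zero thus
strictly decreases the objective (`exists_adaptivePenalty_bounds`). Convexity turns this local
picture into a global one (`exists_isMinOn_and_forall_isMinOn`). This also gives the existence of
minimizers, although `Φ` is not assumed to be lower semicontinuous.

For the probabilistic part, the scores are bounded in probability by Chebyshev's inequality, and
`Q_JJ⁻¹ z_J` is asymptotically normal with covariance `σ² Q_JJ⁻¹` by Lindeberg's central limit
theorem for weighted sums (`tendsto_charFun_weighted_sum`) and Lévy's convergence theorem. By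
Slutsky's theorem the estimator has the same limit.
-/

namespace AdaptiveEstimation

open Matrix

/-! ### Restriction of vectors to a set of coordinates -/

/-- The vector that agrees with `w` on `J` and vanishes elsewhere. -/
def restrictTo {d : ℕ} (J : Finset (Fin d)) (w : Fin d → ℝ) : Fin d → ℝ :=
  fun i => if i ∈ J then w i else 0

theorem supp_subset_iff {d : ℕ} {J : Finset (Fin d)} {w : Fin d → ℝ} :
    supp w ⊆ J ↔ ∀ i, i ∉ J → w i = 0 := by
  simp only [supp, Finset.subset_iff, Finset.mem_filter, Finset.mem_univ, true_and]
  exact forall_congr' fun i => not_imp_comm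

theorem supp_restrictTo_subset {d : ℕ} (J : Finset (Fin d)) (w : Fin d → ℝ) :
    supp (restrictTo J w) ⊆ J :=
  supp_subset_iff.2 fun i hi => by simp [restrictTo, hi]

/-! ### Localization of the minimizers of a convex function -/

theorem lt_of_lt_convex_comb {E : Type*} [AddCommMonoid E] [SMul ℝ≥0 E] {f : E → ℝ≥0∞}
    (hf : ConvexOn ℝ≥0 Set.univ f) {u w : E} {a b : ℝ≥0} (hab : a + b = 1)
    (h : f u < f (a • u + b • w)) : f u < f w := by
  by_contra! hle
  have h1 := hf.2 (Set.mem_univ u) (Set.mem_univ w) zero_le zero_le hab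
  have h2 : a • f u + b • f w ≤ f u := by
    calc a • f u + b • f w ≤ a • f u + b • f u := by gcongr
      _ = f u := by rw [← add_smul, hab, one_smul]
  exact absurd h (not_lt.2 (h1.trans h2))

/-- A convex function that is continuous on the ball of radius `r` around `u0` in the coordinate
subspace of `J`, exceeds `f u0` on its sphere, and strictly decreases when the coordinates outside
`J` are set to zero, attains its minimum over the whole space, and only in that ball. -/
theorem exists_isMinOn_and_forall_isMinOn {d : ℕ} {f : (Fin d → ℝ) → ℝ≥0∞}
    (hf : ConvexOn ℝ≥0 Set.univ f) {J : Finset (Fin d)} {u0 : Fin d → ℝ} (hu0 : supp u0 ⊆ J)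
    {r : ℝ} (hr : 0 < r) (hcont : ContinuousOn f {w | supp w ⊆ J ∧ ‖w - u0‖ ≤ r})
    (hsphere : ∀ w, supp w ⊆ J → ‖w - u0‖ = r → f u0 < f w)
    (hrestrict : ∀ w, ‖restrictTo J w - u0‖ ≤ r → w ≠ restrictTo J w → f (restrictTo J w) < f w) :
    (∃ w, IsMinOn f Set.univ w) ∧ ∀ w, IsMinOn f Set.univ w → supp w ⊆ J ∧ ‖w - u0‖ ≤ r := by
  have hle : ∀ w, ‖restrictTo J w - u0‖ ≤ r → f (restrictTo J w) ≤ f w := fun w hw => by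
    by_cases h : w = restrictTo J w
    · rw [← h]
    · exact (hrestrict w hw h).le
  -- The segment from `u0` to a point outside the cylinder over the ball crosses its boundary.
  have hfar : ∀ w, r < ‖restrictTo J w - u0‖ → f u0 < f w := fun w hw => by
    have hpos : 0 < ‖restrictTo J w - u0‖ := hr.trans hw
    set t : ℝ := r / ‖restrictTo J w - u0‖ with ht
    have ht0 : 0 ≤ t := by positivity
    have ht1 : t ≤ 1 := (div_le_one hpos).2 hw.le
    obtain ⟨b, hb⟩ : ∃ b : ℝ≥0, (b : ℝ) = t := ⟨t.toNNReal, Real.coe_toNNReal t ht0⟩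
    obtain ⟨a, ha⟩ : ∃ a : ℝ≥0, (a : ℝ) = 1 - t :=
      ⟨(1 - t).toNNReal, Real.coe_toNNReal _ (by linarith)⟩
    have hab : a + b = 1 := by ext; simp [ha, hb]
    refine lt_of_lt_convex_comb hf hab ?_
    set p : Fin d → ℝ := a • u0 + b • w with hp
    have hpJ : restrictTo J p - u0 = t • (restrictTo J w - u0) := by
      ext i
      by_cases hi : i ∈ J
      · simp only [restrictTo, hp, hi, if_true, Pi.sub_apply, Pi.add_apply, Pi.smul_apply,
          smul_eq_mul, NNReal.smul_def, ha, hb]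
        ring
      · simp [restrictTo, hi, supp_subset_iff.1 hu0 i hi]
    have hnorm : ‖restrictTo J p - u0‖ = r := by
      rw [hpJ, norm_smul, Real.norm_of_nonneg ht0, ht, div_mul_cancel₀ _ hpos.ne']
    exact (hsphere _ (supp_restrictTo_subset J p) hnorm).trans_le (hle p hnorm.le)
  have hcompact : IsCompact {w : Fin d → ℝ | supp w ⊆ J ∧ ‖w - u0‖ ≤ r} := by
    refine (isCompact_closedBall u0 r).of_isClosed_subset ?_ fun w hw => ?_
    · simp only [supp_subset_iff, Set.ofPred_and]
      refine IsClosed.inter ?_ (isClosed_le (by fun_prop) continuous_const)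
      simp only [Set.ofPred_forall]
      exact isClosed_iInter fun i => isClosed_iInter fun _ =>
        isClosed_eq (continuous_apply i) continuous_const
    · simpa [dist_eq_norm] using hw.2
  have hmem : u0 ∈ {w : Fin d → ℝ | supp w ⊆ J ∧ ‖w - u0‖ ≤ r} := ⟨hu0, by simpa using hr.le⟩
  obtain ⟨m, -, hmin⟩ := hcompact.exists_isMinOn ⟨u0, hmem⟩ hcont
  refine ⟨⟨m, fun w _ => ?_⟩, fun w hw => ?_⟩
  · rcases lt_or_ge r ‖restrictTo J w - u0‖ with h | h
    · exact (hmin hmem).trans (hfar w h).le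
    · exact (hmin (⟨supp_restrictTo_subset J w, h⟩ :
        restrictTo J w ∈ {w | supp w ⊆ J ∧ ‖w - u0‖ ≤ r})).trans (hle w h)
  · have h : ‖restrictTo J w - u0‖ ≤ r := by
      by_contra! hlt
      exact absurd (hfar w hlt) (not_lt.2 (hw (Set.mem_univ u0)))
    have hwJ : w = restrictTo J w := by
      by_contra hne
      exact absurd (hrestrict w h hne) (not_lt.2 (hw (Set.mem_univ _)))
    rw [hwJ]
    exact ⟨supp_restrictTo_subset J w, h⟩

/-! ### The adaptive penalty -/

theorem convexOn_adaptivePenalty {d : ℕ} {Φ : (Fin d → ℝ) → ℝ≥0∞} (hΦ : IsMonotonePenalty Φ)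
    (α : ℝ) (w0 : Fin d → ℝ) : ConvexOn ℝ≥0 Set.univ (adaptivePenalty Φ α w0) := by
  refine ⟨convex_univ, fun u _ w _ a b _ _ hab => ?_⟩
  rcases eq_or_ne a 0 with rfl | ha
  · obtain rfl : b = 1 := by simpa using hab
    simp
  rcases eq_or_ne b 0 with rfl | hb
  · obtain rfl : a = 1 := by simpa using hab
    simp
  by_cases hu : ∃ i, w0 i = 0 ∧ u i ≠ 0
  · have : a • adaptivePenalty Φ α w0 u = ∞ := by
      rw [adaptivePenalty, if_pos hu, ENNReal.smul_def, smul_eq_mul,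
        ENNReal.mul_top (by simpa using ha)]
    simp [this]
  by_cases hw : ∃ i, w0 i = 0 ∧ w i ≠ 0
  · have : b • adaptivePenalty Φ α w0 w = ∞ := by
      rw [adaptivePenalty, if_pos hw, ENNReal.smul_def, smul_eq_mul,
        ENNReal.mul_top (by simpa using hb)]
    simp [this]
  have hm : ¬ ∃ i, w0 i = 0 ∧ (a • u + b • w) i ≠ 0 := by
    push Not at hu hw ⊢
    intro i hi
    simp [hu i hi, hw i hi]
  rw [adaptivePenalty, adaptivePenalty, adaptivePenalty, if_neg hu, if_neg hw, if_neg hm]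
  refine le_trans (hΦ.monotone _ _ ?_)
    (hΦ.convex.2 (Set.mem_univ _) (Set.mem_univ _) zero_le zero_le hab)
  intro i
  have hc : 0 ≤ |w0 i| ^ (α - 1) := by positivity
  simp only [Pi.abs_apply, Pi.add_apply, Pi.smul_apply, NNReal.smul_def, smul_eq_mul]
  rw [abs_of_nonneg (mul_nonneg hc (abs_nonneg _))]
  refine le_trans ?_ (le_abs_self _)
  calc |w0 i| ^ (α - 1) * |(a : ℝ) * u i + b * w i|
      ≤ |w0 i| ^ (α - 1) * (a * |u i| + b * |w i|) := by
        gcongr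
        refine (abs_add_le _ _).trans (le_of_eq ?_)
        rw [abs_mul, abs_mul, NNReal.abs_eq, NNReal.abs_eq]
    _ = a * (|w0 i| ^ (α - 1) * |u i|) + b * (|w0 i| ^ (α - 1) * |w i|) := by ring

theorem convexOn_objective {n d : ℕ} (X : Matrix (Fin n) (Fin d) ℝ) (y : Fin n → ℝ) (lam : ℝ)
    {Φ : (Fin d → ℝ) → ℝ≥0∞} (hΦ : IsMonotonePenalty Φ) (α : ℝ) (w0 : Fin d → ℝ) :
    ConvexOn ℝ≥0 Set.univ (objective X y lam Φ α w0) := by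
  refine ⟨convex_univ, fun u _ w _ a b _ _ hab => ?_⟩
  have hab' : (a : ℝ) + b = 1 := by exact_mod_cast hab
  have hpen := (convexOn_adaptivePenalty hΦ α w0).2 (Set.mem_univ u) (Set.mem_univ w)
    zero_le zero_le hab
  have hloss : 1 / 2 * ∑ i, (y i - X.mulVec (a • u + b • w) i) ^ 2 ≤
      a * (1 / 2 * ∑ i, (y i - X.mulVec u i) ^ 2) +
        b * (1 / 2 * ∑ i, (y i - X.mulVec w i) ^ 2) := by
    have key : ∀ i, (y i - X.mulVec (a • u + b • w) i) ^ 2 ≤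
        a * (y i - X.mulVec u i) ^ 2 + b * (y i - X.mulVec w i) ^ 2 := fun i => by
      have hX : X.mulVec (a • u + b • w) i = a * X.mulVec u i + b * X.mulVec w i := by
        rw [Matrix.mulVec_add, NNReal.smul_def, NNReal.smul_def, Matrix.mulVec_smul,
          Matrix.mulVec_smul]
        rfl
      rw [hX]
      have ha : (a : ℝ) = 1 - b := by linarith
      have hb0 : 0 ≤ (b : ℝ) := b.2
      have ha0 : 0 ≤ 1 - (b : ℝ) := ha ▸ a.2
      rw [ha]
      nlinarith [mul_nonneg (mul_nonneg ha0 hb0) (sq_nonneg (X.mulVec u i - X.mulVec w i))]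
    calc 1 / 2 * ∑ i, (y i - X.mulVec (a • u + b • w) i) ^ 2
        ≤ 1 / 2 * ∑ i, (a * (y i - X.mulVec u i) ^ 2 + b * (y i - X.mulVec w i) ^ 2) := by
          gcongr with i; exact key i
      _ = _ := by rw [Finset.sum_add_distrib, ← Finset.mul_sum, ← Finset.mul_sum]; ring
  calc objective X y lam Φ α w0 (a • u + b • w)
      ≤ ENNReal.ofReal (a * (1 / 2 * ∑ i, (y i - X.mulVec u i) ^ 2) +
          b * (1 / 2 * ∑ i, (y i - X.mulVec w i) ^ 2)) +
        ENNReal.ofReal lam *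
          (a • adaptivePenalty Φ α w0 u + b • adaptivePenalty Φ α w0 w) := by
        unfold objective
        gcongr
    _ = a • objective X y lam Φ α w0 u + b • objective X y lam Φ α w0 w := by
        unfold objective
        rw [ENNReal.ofReal_add (by positivity) (by positivity), ENNReal.ofReal_mul a.coe_nonneg,
          ENNReal.ofReal_mul b.coe_nonneg]
        simp only [ENNReal.smul_def, smul_eq_mul, ENNReal.ofReal_coe_nnreal]
        ring

/-- Near an interior point of its effective domain, a convex `Φ : ℝ^d → [0, +∞]` is finite and
Lipschitz. -/
theorem exists_lipschitz_near_of_mem_interior_effDom {d : ℕ} {Φ : (Fin d → ℝ) → ℝ≥0∞}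
    (hΦ : ConvexOn ℝ≥0 Set.univ Φ) {x : Fin d → ℝ} (hx : x ∈ interior (effDom Φ)) :
    ∃ L : ℝ, 0 ≤ L ∧ ∃ V ∈ 𝓝 x, ∀ u ∈ V, Φ u < ∞ ∧
      ∀ w ∈ V, |(Φ w).toReal - (Φ u).toReal| ≤ L * ‖w - u‖ := by
  have hineq : ∀ ⦃u⦄, ∀ ⦃w⦄, ∀ ⦃a b : ℝ⦄, (ha : 0 ≤ a) → (hb : 0 ≤ b) → a + b = 1 →
      Φ (a • u + b • w) ≤ ENNReal.ofReal a * Φ u + ENNReal.ofReal b * Φ w := by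
    intro u w a b ha hb hab
    lift a to ℝ≥0 using ha
    lift b to ℝ≥0 using hb
    have h := hΦ.2 (Set.mem_univ u) (Set.mem_univ w) (zero_le (a := a)) (zero_le (a := b))
      (by exact_mod_cast hab)
    simpa only [ENNReal.smul_def, smul_eq_mul, ENNReal.ofReal_coe_nnreal, NNReal.smul_def] using h
  have hfin : ∀ ⦃u⦄, Φ u < ∞ → ∀ a : ℝ, ENNReal.ofReal a * Φ u ≠ ∞ := fun u hu a =>
    ENNReal.mul_ne_top ENNReal.ofReal_ne_top hu.ne
  have hconv : ConvexOn ℝ (effDom Φ) fun w => (Φ w).toReal := by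
    refine ⟨fun u hu w hw a b ha hb hab => ?_, fun u hu w hw a b ha hb hab => ?_⟩
    · exact (hineq ha hb hab).trans_lt (ENNReal.add_lt_top.2
        ⟨(hfin hu a).lt_top, (hfin hw b).lt_top⟩)
    · have h := ENNReal.toReal_mono (ENNReal.add_ne_top.2 ⟨hfin hu a, hfin hw b⟩)
        (hineq ha hb hab (u := u) (w := w))
      rw [ENNReal.toReal_add (hfin hu a) (hfin hw b), ENNReal.toReal_mul, ENNReal.toReal_mul,
        ENNReal.toReal_ofReal ha, ENNReal.toReal_ofReal hb] at h
      exact h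
  obtain ⟨L, t, ht, hL⟩ := hconv.locallyLipschitzOn_interior hx
  rw [isOpen_interior.nhdsWithin_eq hx] at ht
  refine ⟨L, L.2, t ∩ interior (effDom Φ), inter_mem ht (isOpen_interior.mem_nhds hx),
    fun u hu => ⟨(interior_subset hu.2 : u ∈ effDom Φ), fun w hw => ?_⟩⟩
  simpa [Real.dist_eq, dist_eq_norm] using hL.dist_le_mul w hw.1 u hu.1

/-- The adaptive penalty near the true vector `wstar` with support `J`, uniformly over initial
estimates `w0` near `wstar`: it is finite and Lipschitz on the coordinate subspace of `J`, and
when `w0` is within `k` of `wstar`, so that its weights outside `J` are at least `k ^ (α - 1)`,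
strong stability makes each coordinate outside `J` cost at least `M * k ^ (α - 1)` per unit. -/
theorem exists_adaptivePenalty_bounds {d : ℕ} {Φ : (Fin d → ℝ) → ℝ≥0∞} (hΦ : IsMonotonePenalty Φ)
    {α : ℝ} (hα0 : 0 < α) (hα1 : α < 1) {wstar : Fin d → ℝ}
    (hdom : (fun i => |wstar i| ^ α) ∈ interior (effDom Φ))
    (hstable : StronglyStable Φ (supp wstar)) :
    ∃ ρ : ℝ, 0 < ρ ∧ ∃ M : ℝ, 0 < M ∧ ∃ L : ℝ, 0 ≤ L ∧
      (∀ w, ‖w - wstar‖ < ρ → supp wstar ⊆ supp w) ∧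
      ∀ w0, ‖w0 - wstar‖ < ρ →
      (∀ u, supp u ⊆ supp wstar → ‖u - wstar‖ < ρ → adaptivePenalty Φ α w0 u < ∞ ∧
        ∀ w, supp w ⊆ supp wstar → ‖w - wstar‖ < ρ →
          |(adaptivePenalty Φ α w0 w).toReal - (adaptivePenalty Φ α w0 u).toReal| ≤ L * ‖w - u‖) ∧
      ∀ w, ‖restrictTo (supp wstar) w - wstar‖ < ρ → ∀ k, 0 < k → ‖w0 - wstar‖ ≤ k →
        adaptivePenalty Φ α w0 (restrictTo (supp wstar) w) +
          ENNReal.ofReal (M * (k ^ (α - 1) * ‖w - restrictTo (supp wstar) w‖)) ≤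
          adaptivePenalty Φ α w0 w := by
  set J := supp wstar with hJ
  have hJmem : ∀ i, i ∈ J ↔ wstar i ≠ 0 := fun i => by simp [hJ, supp]
  obtain ⟨L, hL, V, hV, hVL⟩ := exists_lipschitz_near_of_mem_interior_effDom hΦ.convex hdom
  obtain ⟨M, hM, hdec⟩ := hstable (fun i => |wstar i| ^ α) (supp_subset_iff.2 fun i hi => by
    rw [hJmem, not_not] at hi
    simp [hi, hα0.ne'])
  -- The argument of `Φ`, cut off to the coordinates in `J`, as a function of `(w0, w)`.
  let a : (Fin d → ℝ) × (Fin d → ℝ) → Fin d → ℝ :=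
    fun p i => if i ∈ J then |p.1 i| ^ (α - 1) * |p.2 i| else 0
  have ha_supp : ∀ p, supp (a p) ⊆ J := fun p => supp_subset_iff.2 fun i hi => by simp [a, hi]
  have hwt : ∀ i ∈ J, ContinuousAt (fun p : (Fin d → ℝ) × (Fin d → ℝ) => |p.1 i| ^ (α - 1))
      (wstar, wstar) := fun i hi =>
    ContinuousAt.rpow_const (by fun_prop) (Or.inl (abs_ne_zero.2 ((hJmem i).1 hi)))
  have ha : Tendsto a (𝓝 (wstar, wstar)) (𝓝 fun i => |wstar i| ^ α) := by
    refine tendsto_pi_nhds.2 fun i => ?_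
    by_cases hi : i ∈ J
    · have h0 : 0 < |wstar i| := abs_pos.2 ((hJmem i).1 hi)
      have hval : |wstar i| ^ α = |wstar i| ^ (α - 1) * |wstar i| := by
        rw [← Real.rpow_add_one h0.ne', sub_add_cancel]
      simp only [a, hi, if_true, hval]
      exact (hwt i hi).tendsto.mul (Continuous.tendsto (by fun_prop) _)
    · have hw : wstar i = 0 := by simpa using mt (hJmem i).2 hi
      simp [a, hi, hw, hα0.ne']
  have hev : ∀ᶠ p in 𝓝 (wstar, wstar), (a p ∈ V ∧ (supp (a p) ⊆ J → DecomposableWith Φ J M (a p))) ∧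
      ∀ i ∈ J, |p.1 i| ^ (α - 1) ≤ ∑ j, |wstar j| ^ (α - 1) + 1 ∧ p.1 i ≠ 0 ∧ p.2 i ≠ 0 := by
    refine (ha.eventually (Filter.inter_mem hV hdec)).and ?_
    rw [eventually_all_finset]
    intro i hi
    have h0 := (hJmem i).1 hi
    have h1 : |wstar i| ^ (α - 1) < ∑ j, |wstar j| ^ (α - 1) + 1 :=
      (Finset.single_le_sum (f := fun j => |wstar j| ^ (α - 1)) (fun j _ => by positivity)
        (Finset.mem_univ i)).trans_lt (lt_add_one _)
    have c1 : ContinuousAt (fun p : (Fin d → ℝ) × (Fin d → ℝ) => p.1 i) (wstar, wstar) := by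
      fun_prop
    have c2 : ContinuousAt (fun p : (Fin d → ℝ) × (Fin d → ℝ) => p.2 i) (wstar, wstar) := by
      fun_prop
    filter_upwards [(hwt i hi).eventually_lt_const h1, c1.eventually_ne h0, c2.eventually_ne h0]
      with p h1 h2 h3 using ⟨h1.le, h2, h3⟩
  obtain ⟨ρ, hρ, hball⟩ := Metric.eventually_nhds_iff.1 hev
  have hball' : ∀ w0 w : Fin d → ℝ, ‖w0 - wstar‖ < ρ → ‖w - wstar‖ < ρ → _ := fun w0 w h0 h =>
    hball (y := (w0, w)) (by simpa [Prod.dist_eq, dist_eq_norm] using ⟨h0, h⟩)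
  have hpen : ∀ w0 w : Fin d → ℝ, ‖w0 - wstar‖ < ρ → supp w ⊆ J →
      adaptivePenalty Φ α w0 w = Φ (a (w0, w)) := by
    intro w0 w h0 hw
    have hw' := supp_subset_iff.1 hw
    rw [adaptivePenalty, if_neg]
    · congr 1
      ext i
      by_cases hi : i ∈ J
      · simp [a, hi]
      · simp [a, hi, hw' i hi]
    · rintro ⟨i, hi0, hi⟩
      exact ((hball' w0 wstar h0 (by simpa using hρ)).2 i (by
        by_contra h; exact hi (hw' i h))).2.1 hi0
  set C : ℝ := ∑ j, |wstar j| ^ (α - 1) + 1 with hC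
  have hC0 : 0 ≤ C := by positivity
  refine ⟨ρ, hρ, M, hM, L * C, by positivity, fun w hw => ?_, fun w0 h0 => ⟨fun u hu hu' => ?_,
    fun w hw k hk hk' => ?_⟩⟩
  · intro i hi
    simpa [supp] using ((hball' wstar w (by simpa using hρ) hw).2 i hi).2.2
  · have hub := hball' w0 u h0 hu'
    rw [hpen w0 u h0 hu]
    refine ⟨(hVL _ hub.1.1).1, fun w hw hw' => ?_⟩
    rw [hpen w0 w h0 hw]
    refine ((hVL _ hub.1.1).2 _ (hball' w0 w h0 hw').1.1).trans ?_
    rw [mul_assoc]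
    gcongr
    refine (pi_norm_le_iff_of_nonneg (by positivity)).2 fun i => ?_
    by_cases hi : i ∈ J
    · have h1 : a (w0, w) i - a (w0, u) i = |w0 i| ^ (α - 1) * (|w i| - |u i|) := by
        simp [a, hi]; ring
      rw [Pi.sub_apply, h1, norm_mul, Real.norm_of_nonneg (by positivity), Real.norm_eq_abs]
      gcongr
      · exact (hub.2 i hi).1
      · exact (abs_abs_sub_abs_le _ _).trans (norm_le_pi_norm (w - u) i)
    · simp only [Pi.sub_apply, a, hi, if_false, sub_zero, norm_zero]
      positivity
  · by_cases hinf : ∃ i, w0 i = 0 ∧ w i ≠ 0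
    · rw [show adaptivePenalty Φ α w0 w = ∞ from if_pos hinf]
      exact le_top
    rw [hpen w0 _ h0 (supp_restrictTo_subset J w), adaptivePenalty, if_neg hinf]
    push Not at hinf
    set Δ : Fin d → ℝ := fun i => if i ∈ J then 0 else |w0 i| ^ (α - 1) * |w i| with hΔ
    have hsplit : (fun i => |w0 i| ^ (α - 1) * |w i|) = a (w0, restrictTo J w) + Δ := by
      ext i
      by_cases hi : i ∈ J <;> simp [a, hΔ, restrictTo, hi]
    have hΔsupp : supp Δ ⊆ Jᶜ := supp_subset_iff.2 fun i hi => by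
      rw [Finset.mem_compl, not_not] at hi
      simp [hΔ, hi]
    have hb := hball' w0 (restrictTo J w) h0 hw
    rw [hsplit]
    refine le_trans ?_ (hb.1.2 (ha_supp _) Δ hΔsupp)
    gcongr
    rw [← Real.norm_of_nonneg (Real.rpow_nonneg hk.le (α - 1)), ← norm_smul]
    refine (pi_norm_le_iff_of_nonneg (norm_nonneg _)).2 fun i => ?_
    by_cases hi : i ∈ J
    · simp [restrictTo, hi]
    · refine le_trans ?_ (norm_le_pi_norm Δ i)
      have hws : wstar i = 0 := by simpa using mt (hJmem i).2 hi
      rcases eq_or_ne (w0 i) 0 with h | h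
      · simp [restrictTo, hi, hinf i h]
      · have h1 : |w0 i| ≤ k := by
          have := (norm_le_pi_norm (w0 - wstar) i).trans hk'
          simpa [hws] using this
        have h2 : k ^ (α - 1) ≤ |w0 i| ^ (α - 1) :=
          Real.rpow_le_rpow_of_nonpos (abs_pos.2 h) h1 (by linarith)
        simp only [Pi.smul_apply, Pi.sub_apply, restrictTo, hi, hΔ, if_false, sub_zero, smul_eq_mul,
          norm_mul, Real.norm_eq_abs, abs_abs]
        rw [abs_of_nonneg (Real.rpow_nonneg hk.le _),
          abs_of_nonneg (Real.rpow_nonneg (abs_nonneg (w0 i)) _)]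
        gcongr

/-! ### The quadratic loss in the local parameter -/

/-- The quadratic function `v ↦ ½ vᵀ S v - zᵀ v`. -/
noncomputable def quadLoss {d : ℕ} (S : Matrix (Fin d) (Fin d) ℝ) (z v : Fin d → ℝ) : ℝ :=
  1 / 2 * (v ⬝ᵥ S *ᵥ v) - z ⬝ᵥ v

/-- The normalized score `n^(-1/2) Xᵀ e` of a design with `n` observations. -/
noncomputable def score {n d : ℕ} (X : Matrix (Fin n) (Fin d) ℝ) (e : ℕ → ℝ) : Fin d → ℝ :=
  (√n)⁻¹ • (Xᵀ *ᵥ fun i => e i)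

/-- The least squares loss at `w` is, up to a constant, a quadratic function of the local parameter
`√n (w - wstar)`, with the empirical Gram matrix and the normalized score as coefficients. -/
theorem half_sum_sq_residual_eq {n d : ℕ} (hn : 0 < n) (X : Matrix (Fin n) (Fin d) ℝ)
    (wstar : Fin d → ℝ) (e : ℕ → ℝ) (w : Fin d → ℝ) :
    1 / 2 * ∑ i, (response X wstar e i - X.mulVec w i) ^ 2 =
      1 / 2 * ∑ i : Fin n, e i ^ 2 +
        quadLoss ((n : ℝ)⁻¹ • (Xᵀ * X)) (score X e) (√n • (w - wstar)) := by
  have hn0 : (0 : ℝ) < n := by exact_mod_cast hn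
  have hs : √(n : ℝ) ≠ 0 := (Real.sqrt_pos.2 hn0).ne'
  have hsq : √(n : ℝ) * √n = n := Real.mul_self_sqrt hn0.le
  set h := w - wstar with hh
  have h1 : (√(n : ℝ) • h) ⬝ᵥ ((n : ℝ)⁻¹ • (Xᵀ * X)) *ᵥ (√n • h) = (X *ᵥ h) ⬝ᵥ (X *ᵥ h) := by
    rw [smul_mulVec, mulVec_smul, smul_dotProduct, dotProduct_smul, dotProduct_smul,
      ← mulVec_mulVec, dotProduct_mulVec, vecMul_transpose, smul_eq_mul, smul_eq_mul, smul_eq_mul]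
    field_simp
    rw [sq, hsq]
  have h2 : score X e ⬝ᵥ (√(n : ℝ) • h) = (fun i : Fin n => e i) ⬝ᵥ (X *ᵥ h) := by
    rw [score, smul_dotProduct, dotProduct_smul, smul_smul, inv_mul_cancel₀ hs, one_smul,
      dotProduct_mulVec, mulVec_transpose]
  have h3 : ∀ i, response X wstar e i - X.mulVec w i = e i - (X *ᵥ h) i := fun i => by
    rw [hh, mulVec_sub, response, Pi.sub_apply]; ring
  rw [quadLoss, h1, h2]
  simp only [h3, dotProduct, Finset.mul_sum]
  rw [← Finset.sum_sub_distrib, ← Finset.sum_add_distrib]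
  exact Finset.sum_congr rfl fun i _ => by ring

theorem quadLoss_add {d : ℕ} {S : Matrix (Fin d) (Fin d) ℝ} (hS : Sᵀ = S) (z v δ : Fin d → ℝ) :
    quadLoss S z (v + δ) = quadLoss S z v + δ ⬝ᵥ (S *ᵥ v - z) + 1 / 2 * (δ ⬝ᵥ S *ᵥ δ) := by
  have hsymm : v ⬝ᵥ S *ᵥ δ = δ ⬝ᵥ S *ᵥ v := by
    rw [dotProduct_mulVec, ← mulVec_transpose, hS, dotProduct_comm]
  rw [quadLoss, quadLoss, mulVec_add, add_dotProduct, dotProduct_add, dotProduct_add, hsymm,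
    dotProduct_add, dotProduct_sub, dotProduct_comm z δ]
  ring

theorem abs_dotProduct_le_norm_mul_sum {d : ℕ} (u v : Fin d → ℝ) :
    |u ⬝ᵥ v| ≤ ‖u‖ * ∑ i, |v i| := by
  rw [dotProduct, Finset.mul_sum]
  refine (Finset.abs_sum_le_sum_abs _ _).trans (Finset.sum_le_sum fun i _ => ?_)
  rw [abs_mul]
  gcongr
  exact norm_le_pi_norm u i

/-- The sum of the absolute values of the entries of a matrix. -/
def entrySum {d : ℕ} (A : Matrix (Fin d) (Fin d) ℝ) : ℝ := ∑ i, ∑ j, |A i j|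

theorem sum_abs_mulVec_le {d : ℕ} (A : Matrix (Fin d) (Fin d) ℝ) (v : Fin d → ℝ) :
    ∑ i, |(A *ᵥ v) i| ≤ entrySum A * ‖v‖ := by
  rw [entrySum, Finset.sum_mul]
  refine Finset.sum_le_sum fun i _ => ?_
  rw [mulVec, dotProduct_comm, mul_comm]
  exact abs_dotProduct_le_norm_mul_sum v (A i)

theorem abs_dotProduct_mulVec_le {d : ℕ} (A : Matrix (Fin d) (Fin d) ℝ) (v : Fin d → ℝ) :
    |v ⬝ᵥ A *ᵥ v| ≤ entrySum A * ‖v‖ ^ 2 :=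
  calc |v ⬝ᵥ A *ᵥ v| ≤ ‖v‖ * (entrySum A * ‖v‖) :=
        (abs_dotProduct_le_norm_mul_sum _ _).trans (by gcongr; exact sum_abs_mulVec_le A v)
    _ = _ := by ring

theorem continuous_entrySum {d : ℕ} :
    Continuous (entrySum : Matrix (Fin d) (Fin d) ℝ → ℝ) := by
  unfold entrySum
  fun_prop

theorem quadLoss_sub_le_quadLoss_add {d : ℕ} {S : Matrix (Fin d) (Fin d) ℝ} (hS : S.PosSemidef)
    (z v δ : Fin d → ℝ) :
    quadLoss S z v - (entrySum S * ‖v‖ + d * ‖z‖) * ‖δ‖ ≤ quadLoss S z (v + δ) := by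
  rw [quadLoss_add (by simpa using hS.1.eq)]
  have h1 : 0 ≤ δ ⬝ᵥ S *ᵥ δ := by simpa using hS.dotProduct_mulVec_nonneg δ
  have h2 : ∑ i, |(S *ᵥ v - z) i| ≤ entrySum S * ‖v‖ + d * ‖z‖ :=
    calc ∑ i, |(S *ᵥ v - z) i| ≤ ∑ i, (|(S *ᵥ v) i| + ‖z‖) :=
          Finset.sum_le_sum fun i _ => (abs_sub _ _).trans (by gcongr; exact norm_le_pi_norm z i)
      _ ≤ entrySum S * ‖v‖ + d * ‖z‖ := by
          rw [Finset.sum_add_distrib]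
          simpa using sum_abs_mulVec_le S v
  have h3 := (abs_dotProduct_le_norm_mul_sum δ (S *ᵥ v - z)).trans
    (mul_le_mul_of_nonneg_left h2 (norm_nonneg δ))
  nlinarith [(abs_le.1 h3).1]

theorem exists_coercivity_const {d : ℕ} {Q : Matrix (Fin d) (Fin d) ℝ} (hQ : Q.PosDef) :
    ∃ c : ℝ, 0 < c ∧ ∀ v : Fin d → ℝ, c * ‖v‖ ^ 2 ≤ v ⬝ᵥ Q *ᵥ v := by
  obtain ⟨c, hc, h⟩ := (isCompact_sphere (0 : Fin d → ℝ) 1).exists_forall_le'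
    (f := fun v => v ⬝ᵥ Q *ᵥ v) (a := 0)
    (Continuous.continuousOn (by fun_prop)) fun v hv => by
      have hv0 : v ≠ 0 := by rintro rfl; simp at hv
      simpa using hQ.dotProduct_mulVec_pos hv0
  refine ⟨c, hc, fun v => ?_⟩
  rcases eq_or_ne v 0 with rfl | hv
  · simp
  have hv' : 0 < ‖v‖ := norm_pos_iff.2 hv
  have h1 := h (‖v‖⁻¹ • v) (by simp [norm_smul, hv'.ne'])
  rw [mulVec_smul, smul_dotProduct, dotProduct_smul, smul_eq_mul, smul_eq_mul] at h1
  calc c * ‖v‖ ^ 2 ≤ ‖v‖⁻¹ * (‖v‖⁻¹ * (v ⬝ᵥ Q *ᵥ v)) * ‖v‖ ^ 2 := by gcongr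
    _ = v ⬝ᵥ Q *ᵥ v := by field_simp

/-- If `v0` minimizes the quadratic loss with matrix `Q` over the coordinate subspace of `J`, then
the loss with a matrix `S` close to `Q` grows quadratically around `v0` up to the error of
replacing `Q` by `S`. -/
theorem quadLoss_growth {d : ℕ} {Q : Matrix (Fin d) (Fin d) ℝ} (hQ : Qᵀ = Q) {c : ℝ}
    (hc : ∀ v : Fin d → ℝ, c * ‖v‖ ^ 2 ≤ v ⬝ᵥ Q *ᵥ v) (S : Matrix (Fin d) (Fin d) ℝ)
    {J : Finset (Fin d)} {z v0 v : Fin d → ℝ} (hv0 : supp v0 ⊆ J) (hv : supp v ⊆ J)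
    (hz : ∀ i ∈ J, (Q *ᵥ v0) i = z i) {R : ℝ} (hv0R : ‖v0‖ ≤ R) (hvR : ‖v‖ ≤ R) :
    quadLoss S z v0 + c / 2 * ‖v - v0‖ ^ 2 - entrySum (S - Q) * R ^ 2 ≤ quadLoss S z v := by
  have horth : (v - v0) ⬝ᵥ (Q *ᵥ v0 - z) = 0 := Finset.sum_eq_zero fun i _ => by
    by_cases hi : i ∈ J
    · simp [hz i hi]
    · simp [supp_subset_iff.1 hv i hi, supp_subset_iff.1 hv0 i hi]
  have hexp := quadLoss_add hQ z v0 (v - v0)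
  rw [add_sub_cancel, horth] at hexp
  have hdiff : ∀ u, quadLoss S z u = quadLoss Q z u + 1 / 2 * (u ⬝ᵥ (S - Q) *ᵥ u) := fun u => by
    rw [quadLoss, quadLoss, sub_mulVec, dotProduct_sub]; ring
  have hA : 0 ≤ entrySum (S - Q) :=
    Finset.sum_nonneg fun i _ => Finset.sum_nonneg fun j _ => abs_nonneg _
  have hbd : ∀ u : Fin d → ℝ, ‖u‖ ≤ R → |u ⬝ᵥ (S - Q) *ᵥ u| ≤ entrySum (S - Q) * R ^ 2 :=
    fun u hu => (abs_dotProduct_mulVec_le _ u).trans (by gcongr)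
  have h1 := abs_le.1 (hbd v hvR)
  have h2 := abs_le.1 (hbd v0 hv0R)
  have h3 := hc (v - v0)
  rw [hdiff, hdiff v]
  linarith [h1.1, h2.2]

/-! ### The minimizers of the objective for a given realization of the noise -/

theorem objective_eq_ofReal {n d : ℕ} (X : Matrix (Fin n) (Fin d) ℝ) (y : Fin n → ℝ) {lam : ℝ}
    (hlam : 0 ≤ lam) (Φ : (Fin d → ℝ) → ℝ≥0∞) (α : ℝ) (w0 w : Fin d → ℝ)
    (h : adaptivePenalty Φ α w0 w < ∞) :
    objective X y lam Φ α w0 w = ENNReal.ofReal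
      (1 / 2 * ∑ i, (y i - X.mulVec w i) ^ 2 + lam * (adaptivePenalty Φ α w0 w).toReal) := by
  rw [objective, ENNReal.ofReal_add (by positivity) (by positivity), ENNReal.ofReal_mul hlam,
    ENNReal.ofReal_toReal h.ne]

/-- Uniformly over noise vectors and initial estimates whose normalized score and normalized error
are bounded by `K`, for large `n` the objective has a minimizer, and every minimizer has the true
support and a local parameter within `η` of the minimizer `v0` of the unpenalized limiting
quadratic on that support. -/
theorem eventually_isAdaptiveEstimate_near {d : ℕ}
    {Φ : (Fin d → ℝ) → ℝ≥0∞} (hΦ : IsMonotonePenalty Φ)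
    {α : ℝ} (hα0 : 0 < α) (hα1 : α < 1) {wstar : Fin d → ℝ}
    (hdom : (fun i => |wstar i| ^ α) ∈ interior (effDom Φ))
    (hstable : StronglyStable Φ (supp wstar))
    {X : (n : ℕ) → Matrix (Fin n) (Fin d) ℝ} {Q : Matrix (Fin d) (Fin d) ℝ} (hQ : Q.PosDef)
    (hXQ : Tendsto (fun n : ℕ => (n : ℝ)⁻¹ • ((X n)ᵀ * X n)) atTop (𝓝 Q))
    {lam : ℕ → ℝ} (hlam : ∀ n, 0 < lam n)
    (hlam0 : Tendsto (fun n : ℕ => lam n / √n) atTop (𝓝 0))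
    (hlamtop : Tendsto (fun n : ℕ => lam n / (n : ℝ) ^ (α / 2)) atTop atTop)
    {K η : ℝ} (hK : 0 < K) (hη : 0 < η) :
    ∀ᶠ n : ℕ in atTop, ∀ (e : ℕ → ℝ) (w0 v0 : Fin d → ℝ), √n * ‖w0 - wstar‖ ≤ K →
      ‖score (X n) e‖ ≤ K → ‖v0‖ ≤ K → supp v0 ⊆ supp wstar →
      (∀ i ∈ supp wstar, (Q *ᵥ v0) i = score (X n) e i) →
      (∃ w, IsAdaptiveEstimate (X n) (response (X n) wstar e) (lam n) Φ α w0 w) ∧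
      ∀ w, IsAdaptiveEstimate (X n) (response (X n) wstar e) (lam n) Φ α w0 w →
        supp w = supp wstar ∧ ‖√n • (w - wstar) - v0‖ ≤ η := by
  obtain ⟨ρ, hρ, M, hM, L, hL, hsupp, hpen⟩ :=
    exists_adaptivePenalty_bounds hΦ hα0 hα1 hdom hstable
  obtain ⟨c, hc, hcoer⟩ := exists_coercivity_const hQ
  set J := supp wstar
  have hJ : supp wstar ⊆ J := Finset.Subset.refl _
  set R := K + η with hR
  have hsqrt : Tendsto (fun n : ℕ => √(n : ℝ)) atTop atTop :=
    Real.tendsto_sqrt_atTop.comp tendsto_natCast_atTop_atTop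
  have ev1 : ∀ᶠ n : ℕ in atTop, R / √n < ρ :=
    (tendsto_const_nhds.div_atTop hsqrt).eventually_lt_const hρ
  have ev2 : ∀ᶠ n : ℕ in atTop, entrySum ((n : ℝ)⁻¹ • ((X n)ᵀ * X n)) < entrySum Q + 1 :=
    ((continuous_entrySum.tendsto Q).comp hXQ).eventually_lt_const (lt_add_one _)
  have ev3 : ∀ᶠ n : ℕ in atTop, entrySum ((n : ℝ)⁻¹ • ((X n)ᵀ * X n) - Q) * R ^ 2 +
      lam n / √n * (L * η) < c / 2 * η ^ 2 := by
    have h0 : Tendsto (fun n : ℕ => entrySum ((n : ℝ)⁻¹ • ((X n)ᵀ * X n) - Q)) atTop (𝓝 0) := by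
      have := (continuous_entrySum.tendsto (Q - Q)).comp (hXQ.sub_const Q)
      rwa [sub_self, show entrySum (0 : Matrix (Fin d) (Fin d) ℝ) = 0 by simp [entrySum]] at this
    have h1 := (h0.mul_const (R ^ 2)).add (hlam0.mul_const (L * η))
    rw [zero_mul, zero_mul, add_zero] at h1
    exact h1.eventually_lt_const (by positivity)
  set B := (entrySum Q + 1) * R + d * K with hB
  have ev4 : ∀ᶠ n : ℕ in atTop, B / (M * K ^ (α - 1)) < lam n / (n : ℝ) ^ (α / 2) :=
    hlamtop.eventually_gt_atTop _
  filter_upwards [ev1, ev2, ev3, ev4, eventually_gt_atTop 0] with n h1 h2 h3 h4 hn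
    e w0 v0 hw0 hz hv0 hv0J hQv0
  have hn0 : (0 : ℝ) < n := by exact_mod_cast hn
  have hs : 0 < √(n : ℝ) := Real.sqrt_pos.2 hn0
  set S := (n : ℝ)⁻¹ • ((X n)ᵀ * X n) with hS
  have hSpsd : S.PosSemidef := by
    simpa using (posSemidef_conjTranspose_mul_self (X n)).smul (inv_nonneg.2 hn0.le)
  set z := score (X n) e
  have hn' := hlam n
  have hw0' : ‖w0 - wstar‖ ≤ K / √n := by rwa [le_div_iff₀ hs, mul_comm]
  have hw0ρ : ‖w0 - wstar‖ < ρ := hw0'.trans_lt <| h1.trans_le' (by gcongr; linarith)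
  set u0 : Fin d → ℝ := wstar + (√(n : ℝ))⁻¹ • v0 with hu0
  have hu0J : supp u0 ⊆ J := supp_subset_iff.2 fun i hi => by
    simp [hu0, supp_subset_iff.1 hv0J i hi, supp_subset_iff.1 hJ i hi]
  have hlocal : ∀ w : Fin d → ℝ, √(n : ℝ) • (w - wstar) - v0 = √(n : ℝ) • (w - u0) := fun w => by
    rw [hu0, ← sub_sub, smul_sub _ (w - wstar), smul_smul, mul_inv_cancel₀ hs.ne', one_smul]
  have hlocal' : ∀ w : Fin d → ℝ, ‖√(n : ℝ) • (w - wstar) - v0‖ = √(n : ℝ) * ‖w - u0‖ :=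
    fun w => by rw [hlocal, norm_smul, Real.norm_of_nonneg hs.le]
  have hsuppv : ∀ w : Fin d → ℝ, supp w ⊆ J → supp (√(n : ℝ) • (w - wstar)) ⊆ J := fun w hw =>
    supp_subset_iff.2 fun i hi => by
      simp [supp_subset_iff.1 hw i hi, supp_subset_iff.1 hJ i hi]
  have hnormv : ∀ w : Fin d → ℝ, ‖w - u0‖ ≤ η / √n → ‖√(n : ℝ) • (w - wstar)‖ ≤ R := fun w hw => by
    have h5 : ‖√(n : ℝ) • (w - wstar) - v0‖ ≤ η := by
      rw [hlocal', mul_comm]; exact (le_div_iff₀ hs).1 hw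
    calc ‖√(n : ℝ) • (w - wstar)‖ = ‖v0 + (√(n : ℝ) • (w - wstar) - v0)‖ := by
          rw [add_sub_cancel]
      _ ≤ R := (norm_add_le _ _).trans (add_le_add hv0 h5)
  have hnear : ∀ w : Fin d → ℝ, ‖w - u0‖ ≤ η / √n → ‖w - wstar‖ < ρ := fun w hw => by
    have h5 := hnormv w hw
    rw [norm_smul, Real.norm_of_nonneg hs.le, mul_comm, ← le_div_iff₀ hs] at h5
    exact h5.trans_lt h1
  have hu0near : ‖u0 - u0‖ ≤ η / √n := by simpa using (div_pos hη hs).le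
  have hres := half_sum_sq_residual_eq hn (X n) wstar e
  have key := exists_isMinOn_and_forall_isMinOn
    (convexOn_objective (X n) (response (X n) wstar e) (lam n) hΦ α w0) hu0J (div_pos hη hs)
    ?_ ?_ ?_
  · refine ⟨key.1, fun w hw => ?_⟩
    obtain ⟨hwJ, hwu⟩ := key.2 w hw
    refine ⟨hwJ.antisymm (hsupp w (hnear w hwu)), ?_⟩
    rw [hlocal', mul_comm]
    exact (le_div_iff₀ hs).1 hwu
  · have hpc : ContinuousOn (adaptivePenalty Φ α w0)
        {w | supp w ⊆ J ∧ ‖w - u0‖ ≤ η / √n} := by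
      have hlip : ContinuousOn (fun w => (adaptivePenalty Φ α w0 w).toReal)
          {w | supp w ⊆ J ∧ ‖w - u0‖ ≤ η / √n} := by
        refine (LipschitzOnWith.of_dist_le_mul (K := L.toNNReal) fun w hw u hu => ?_).continuousOn
        rw [Real.dist_eq, dist_eq_norm, Real.coe_toNNReal L hL]
        exact ((hpen w0 hw0ρ).1 u hu.1 (hnear u hu.2)).2 w hw.1 (hnear w hw.2)
      exact (ENNReal.continuous_ofReal.comp_continuousOn hlip).congr fun w hw =>
        (ENNReal.ofReal_toReal ((hpen w0 hw0ρ).1 w hw.1 (hnear w hw.2)).1.ne).symm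
    refine ContinuousOn.add (Continuous.continuousOn ?_)
      ((ENNReal.continuous_const_mul ENNReal.ofReal_ne_top).comp_continuousOn hpc)
    exact ENNReal.continuous_ofReal.comp (by fun_prop)
  · intro w hwJ hw
    have hpu := (hpen w0 hw0ρ).1 u0 hu0J (hnear u0 hu0near)
    have hpw := (hpen w0 hw0ρ).1 w hwJ (hnear w hw.le)
    rw [objective_eq_ofReal _ _ hn'.le _ _ _ _ hpu.1, objective_eq_ofReal _ _ hn'.le _ _ _ _ hpw.1,
      ENNReal.ofReal_lt_ofReal_iff_of_nonneg (by positivity), hres, hres]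
    have hu0v : √(n : ℝ) • (u0 - wstar) = v0 := by simp [hu0, smul_smul, hs.ne']
    have hgrow := quadLoss_growth (by simpa using hQ.1.eq) hcoer S hv0J (hsuppv w hwJ) hQv0
      (hv0.trans (by linarith)) (hnormv w hw.le)
    have hη' : ‖√(n : ℝ) • (w - wstar) - v0‖ = η := by
      rw [hlocal', hw]; field_simp
    rw [hη'] at hgrow
    have h5 := mul_le_mul_of_nonneg_left (abs_le.1 (hpu.2 w hwJ (hnear w hw.le))).1 hn'.le
    rw [hw] at h5
    have h6 : lam n * (L * (η / √n)) = lam n / √n * (L * η) := by ring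
    rw [hu0v]
    linarith
  · intro w hw hne
    set wJ := restrictTo J w with hwJ
    have hwJJ : supp wJ ⊆ J := supp_restrictTo_subset J w
    have hpw := (hpen w0 hw0ρ).1 wJ hwJJ (hnear wJ hw)
    have hk : 0 < K / √n := div_pos hK hs
    have hbig := (hpen w0 hw0ρ).2 w (hnear wJ hw) (K / √n) hk hw0'
    rw [objective_eq_ofReal _ _ hn'.le _ _ _ _ hpw.1]
    have hkα : 0 ≤ (K / √n) ^ (α - 1) := by positivity
    have hlow : ENNReal.ofReal (1 / 2 * ∑ i, (response (X n) wstar e i - (X n).mulVec w i) ^ 2 +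
        lam n * ((adaptivePenalty Φ α w0 wJ).toReal +
          M * ((K / √n) ^ (α - 1) * ‖w - wJ‖))) ≤
        objective (X n) (response (X n) wstar e) (lam n) Φ α w0 w := by
      rw [objective, ENNReal.ofReal_add (by positivity) (by positivity),
        ENNReal.ofReal_mul hn'.le, ENNReal.ofReal_add (by positivity) (by positivity),
        ENNReal.ofReal_toReal hpw.1.ne]
      gcongr
    refine lt_of_lt_of_le ?_ hlow
    rw [ENNReal.ofReal_lt_ofReal_iff_of_nonneg (by positivity), hres, hres]
    have hpos : 0 < ‖w - wJ‖ := norm_pos_iff.2 (sub_ne_zero.2 hne)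
    have hq := quadLoss_sub_le_quadLoss_add hSpsd z (√(n : ℝ) • (wJ - wstar))
      (√(n : ℝ) • (w - wJ))
    rw [← smul_add, sub_add_sub_cancel', norm_smul (√(n : ℝ)) (w - wJ),
      Real.norm_of_nonneg hs.le] at hq
    have hBle : (entrySum S * ‖√(n : ℝ) • (wJ - wstar)‖ + d * ‖z‖) ≤ B := by
      have hQ0 : 0 ≤ entrySum Q :=
        Finset.sum_nonneg fun i _ => Finset.sum_nonneg fun j _ => abs_nonneg _
      rw [hB]
      gcongr
      exact hnormv wJ hw
    -- `lam * (K / √n) ^ (α - 1) = √n * K ^ (α - 1) * (lam / n ^ (α / 2))`: the price of a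
    -- coordinate outside `J` outgrows the slope of the loss, which is of order `√n`.
    have hscale : lam n * (K / √n) ^ (α - 1) =
        √n * (K ^ (α - 1) * (lam n / (n : ℝ) ^ (α / 2))) := by
      have e1 : (n : ℝ) ^ (α / 2) = √n ^ α := by
        rw [Real.sqrt_eq_rpow, ← Real.rpow_mul hn0.le]; congr 1; ring
      have e2 : √(n : ℝ) ^ (α - 1) = √n ^ α / √n := Real.rpow_sub_one hs.ne' α
      rw [Real.div_rpow hK.le hs.le, e1, e2]
      have : 0 < √(n : ℝ) ^ α := by positivity
      field_simp
    have hslope : B * √n < lam n * (M * (K / √n) ^ (α - 1)) := by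
      rw [div_lt_iff₀ (by positivity)] at h4
      calc B * √n < lam n / (n : ℝ) ^ (α / 2) * (M * K ^ (α - 1)) * √n := by gcongr
        _ = M * (lam n * (K / √n) ^ (α - 1)) := by rw [hscale]; ring
        _ = _ := by ring
    have h7 : (entrySum S * ‖√(n : ℝ) • (wJ - wstar)‖ + d * ‖z‖) * (√n * ‖w - wJ‖) <
        lam n * (M * ((K / √n) ^ (α - 1) * ‖w - wJ‖)) :=
      calc (entrySum S * ‖√(n : ℝ) • (wJ - wstar)‖ + d * ‖z‖) * (√n * ‖w - wJ‖)
          ≤ B * (√n * ‖w - wJ‖) := by gcongr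
        _ = B * √n * ‖w - wJ‖ := by ring
        _ < lam n * (M * (K / √n) ^ (α - 1)) * ‖w - wJ‖ := by gcongr
        _ = _ := by ring
    rw [mul_add]
    linarith

/-! ### A central limit theorem for weighted sums -/

theorem norm_prod_sub_prod_le_sum {ι : Type*} (s : Finset ι) (a b : ι → ℂ)
    (ha : ∀ i, ‖a i‖ ≤ 1) (hb : ∀ i, ‖b i‖ ≤ 1) :
    ‖∏ i ∈ s, a i - ∏ i ∈ s, b i‖ ≤ ∑ i ∈ s, ‖a i - b i‖ := by
  classical
  induction s using Finset.induction_on with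
  | empty => simp
  | insert i s hi ih =>
    rw [Finset.prod_insert hi, Finset.prod_insert hi, Finset.sum_insert hi]
    have hb' : ‖∏ j ∈ s, b j‖ ≤ 1 := by
      rw [norm_prod]
      exact Finset.prod_le_one (fun _ _ => norm_nonneg _) fun j _ => hb j
    calc ‖a i * ∏ j ∈ s, a j - b i * ∏ j ∈ s, b j‖
        = ‖(a i - b i) * ∏ j ∈ s, b j + a i * (∏ j ∈ s, a j - ∏ j ∈ s, b j)‖ := by
          congr 1; ring
      _ ≤ ‖a i - b i‖ * 1 + 1 * ∑ j ∈ s, ‖a j - b j‖ := by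
          refine (norm_add_le _ _).trans ?_
          rw [norm_mul, norm_mul]
          gcongr
          exact ha i
      _ = _ := by ring

section CLT

variable {Ω : Type*} [MeasurableSpace Ω] {μ : Measure Ω}

/-- The characteristic function of a centered square integrable random variable agrees with that
of the Gaussian of the same variance up to `o(t²)` at `0`. -/
theorem isLittleO_charFun_sub_exp [IsProbabilityMeasure μ] {Y : Ω → ℝ} {σ : ℝ} (hL2 : MemLp Y 2 μ)
    (hmean : ∫ ω, Y ω ∂μ = 0) (hvar : variance Y μ = σ ^ 2) :
    (fun t : ℝ => charFun (μ.map Y) t - Complex.exp (-(σ ^ 2 * t ^ 2 / 2) : ℝ)) =o[𝓝 0]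
      fun t : ℝ => t ^ 2 := by
  have hY : AEMeasurable Y μ := hL2.1.aemeasurable
  have hsq : μ[Y ^ 2] = σ ^ 2 := by
    rw [← hvar, variance_of_integral_eq_zero hY hmean]
    rfl
  have hmap : MemLp id 2 (μ.map Y) :=
    (memLp_map_measure_iff aestronglyMeasurable_id hY).2 hL2
  have : IsProbabilityMeasure (μ.map Y) := Measure.isProbabilityMeasure_map hY
  have h1 : (fun t : ℝ => charFun (μ.map Y) t - (1 - (σ ^ 2 * t ^ 2 / 2 : ℝ))) =o[𝓝 0]
      fun t : ℝ => t ^ 2 := by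
    have h := taylor_isLittleO_univ (x₀ := 0) (contDiff_charFun (n := 2) hmap)
    simp only [sub_zero] at h
    refine h.congr_left fun t => ?_
    rw [taylorWithinEval_charFun_two_zero hY hmap, hmean, hsq]
    push_cast
    ring
  have h2 : (fun t : ℝ => Complex.exp (-(σ ^ 2 * t ^ 2 / 2) : ℝ) -
      (1 - (σ ^ 2 * t ^ 2 / 2 : ℝ))) =o[𝓝 0] fun t : ℝ => t ^ 2 := by
    have h := (Complex.hasDerivAt_exp 0).isLittleO
    have hlim : Tendsto (fun t : ℝ => ((-(σ ^ 2 * t ^ 2 / 2) : ℝ) : ℂ)) (𝓝 0) (𝓝 0) := by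
      have : Continuous fun t : ℝ => ((-(σ ^ 2 * t ^ 2 / 2) : ℝ) : ℂ) := by fun_prop
      simpa using this.tendsto 0
    have h' := h.comp_tendsto hlim
    have hO : (fun t : ℝ => ((-(σ ^ 2 * t ^ 2 / 2) : ℝ) : ℂ) - 0) =O[𝓝 0] fun t : ℝ => t ^ 2 := by
      refine Asymptotics.IsBigO.of_bound (σ ^ 2 / 2) (Eventually.of_forall fun t => ?_)
      rw [sub_zero, Complex.norm_real, norm_neg, Real.norm_of_nonneg (by positivity),
        Real.norm_of_nonneg (by positivity)]
      exact le_of_eq (by ring)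
    refine (h'.trans_isBigO hO).congr_left fun t => ?_
    simp only [Function.comp_apply, Complex.exp_zero, sub_zero, smul_eq_mul, mul_one]
    push_cast
    ring
  exact (h1.sub h2).congr_left fun t => by ring

variable {ε : ℕ → Ω → ℝ} {σ : ℝ}

/-- Lindeberg's central limit theorem, in terms of characteristic functions, for weighted sums of
independent identically distributed variables with uniformly vanishing weights. -/
theorem tendsto_charFun_weighted_sum [IsProbabilityMeasure μ] (hindep : iIndepFun ε μ)
    (hident : ∀ i, IdentDistrib (ε i) (ε 0) μ μ) (hL2 : MemLp (ε 0) 2 μ)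
    (hmean : ∫ ω, ε 0 ω ∂μ = 0) (hvar : variance (ε 0) μ = σ ^ 2)
    {c : (n : ℕ) → Fin n → ℝ} {s : ℝ} (hs : Tendsto (fun n => ∑ k, c n k ^ 2) atTop (𝓝 s))
    (hc : ∀ δ : ℝ, 0 < δ → ∀ᶠ n in atTop, ∀ k, |c n k| ≤ δ) :
    Tendsto (fun n => charFun (μ.map fun ω => ∑ k, c n k * ε k ω) 1) atTop
      (𝓝 (Complex.exp (-(σ ^ 2 * s / 2) : ℝ))) := by
  have hmeas : ∀ i, AEMeasurable (ε i) μ := fun i => (hident i).aemeasurable_fst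
  have : IsProbabilityMeasure (μ.map (ε 0)) := Measure.isProbabilityMeasure_map (hmeas 0)
  have hprod : ∀ n, charFun (μ.map fun ω => ∑ k, c n k * ε k ω) 1 =
      ∏ k, charFun (μ.map (ε 0)) (c n k) := fun n => by
    have hi : iIndepFun (fun (k : Fin n) ω => c n k * ε k ω) μ :=
      (hindep.precomp Fin.val_injective).comp (fun k x => c n k * x) fun k => by fun_prop
    rw [iIndepFun.charFun_map_fun_sum_eq_prod (fun k : Fin n => (hmeas k).const_mul (c n k)) hi,
      Finset.prod_apply]
    refine Finset.prod_congr rfl fun k _ => ?_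
    rw [charFun_map_mul_comp (hmeas k), mul_one, (hident k).map_eq]
  have hgauss : ∀ n, Complex.exp (-(σ ^ 2 * (∑ k, c n k ^ 2) / 2) : ℝ) =
      ∏ k, Complex.exp (-(σ ^ 2 * c n k ^ 2 / 2) : ℝ) := fun n => by
    rw [← Complex.exp_sum, ← Complex.ofReal_sum, Finset.sum_neg_distrib, ← Finset.sum_div,
      Finset.mul_sum]
  have hlim : Tendsto (fun n => Complex.exp (-(σ ^ 2 * (∑ k, c n k ^ 2) / 2) : ℝ)) atTop
      (𝓝 (Complex.exp (-(σ ^ 2 * s / 2) : ℝ))) := by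
    have hcont : Continuous fun x : ℝ => Complex.exp (-(σ ^ 2 * x / 2) : ℝ) := by fun_prop
    exact (hcont.tendsto s).comp hs
  have hdiff : Tendsto (fun n => charFun (μ.map fun ω => ∑ k, c n k * ε k ω) 1 -
      Complex.exp (-(σ ^ 2 * (∑ k, c n k ^ 2) / 2) : ℝ)) atTop (𝓝 0) := by
    refine NormedAddGroup.tendsto_nhds_zero.2 fun r hr => ?_
    have hs0 : 0 ≤ s := ge_of_tendsto' hs fun n => by positivity
    have hr' : 0 < r / (s + 2) := by positivity
    obtain ⟨δ, hδ, hφ⟩ := Metric.eventually_nhds_iff.1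
      ((isLittleO_charFun_sub_exp hL2 hmean hvar).bound hr')
    filter_upwards [hc (δ / 2) (by positivity), hs.eventually_lt_const (lt_add_one s)] with n h1 h2
    rw [hprod, hgauss]
    calc ‖∏ k, charFun (μ.map (ε 0)) (c n k) - ∏ k, Complex.exp (-(σ ^ 2 * c n k ^ 2 / 2) : ℝ)‖
        ≤ ∑ k, ‖charFun (μ.map (ε 0)) (c n k) - Complex.exp (-(σ ^ 2 * c n k ^ 2 / 2) : ℝ)‖ := by
          refine norm_prod_sub_prod_le_sum _ _ _ (fun k => norm_charFun_le_one _) fun k => ?_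
          rw [Complex.norm_exp_ofReal]
          exact Real.exp_le_one_iff.2 (neg_nonpos.2 (by positivity))
      _ ≤ ∑ k, r / (s + 2) * c n k ^ 2 := by
          refine Finset.sum_le_sum fun k _ => ?_
          have h3 := hφ (y := c n k) (by
            rw [dist_zero_right, Real.norm_eq_abs]; exact (h1 k).trans_lt (by linarith))
          rwa [Real.norm_of_nonneg (sq_nonneg (c n k))] at h3
      _ ≤ r / (s + 2) * (s + 1) := by
          rw [← Finset.mul_sum]
          gcongr
      _ < r := by
          rw [div_mul_eq_mul_div, div_lt_iff₀ (by positivity)]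
          nlinarith
  simpa using hdiff.add hlim

theorem variance_weighted_sum (hindep : iIndepFun ε μ)
    (hident : ∀ i, IdentDistrib (ε i) (ε 0) μ μ) (hL2 : MemLp (ε 0) 2 μ)
    (hvar : variance (ε 0) μ = σ ^ 2) {n : ℕ} (c : Fin n → ℝ) :
    variance (fun ω => ∑ k, c k * ε k ω) μ = σ ^ 2 * ∑ k, c k ^ 2 := by
  have h := IndepFun.variance_sum (μ := μ) (s := Finset.univ)
    (X := fun (k : Fin n) ω => c k * ε k ω)
    (fun k _ => ((hident k).memLp_iff.2 hL2).const_mul (c k)) fun i _ j _ hij =>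
      ((hindep.precomp Fin.val_injective).comp (fun (k : Fin n) x => c k * x)
        fun k => by fun_prop).indepFun hij
  have hfun : (∑ k, fun ω => c k * ε k ω) = fun ω => ∑ k, c k * ε k ω := by
    ext ω; simp
  rw [hfun] at h
  rw [h, Finset.mul_sum]
  refine Finset.sum_congr rfl fun k _ => ?_
  rw [variance_const_mul, (hident k).variance_eq, hvar, mul_comm]

/-! ### The normalized score -/

theorem score_dotProduct {n d : ℕ} (X : Matrix (Fin n) (Fin d) ℝ) (e : ℕ → ℝ) (u : Fin d → ℝ) :
    score X e ⬝ᵥ u = ∑ k, ((√n)⁻¹ * (X *ᵥ u) k) * e k := by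
  rw [score, smul_dotProduct, mulVec_transpose, ← dotProduct_mulVec, dotProduct, smul_eq_mul,
    Finset.mul_sum]
  exact Finset.sum_congr rfl fun k _ => by ring

theorem sum_sq_inv_sqrt_mul_mulVec {n d : ℕ} (X : Matrix (Fin n) (Fin d) ℝ) (u : Fin d → ℝ) :
    ∑ k, ((√n)⁻¹ * (X *ᵥ u) k) ^ 2 = u ⬝ᵥ ((n : ℝ)⁻¹ • (Xᵀ * X)) *ᵥ u := by
  rw [smul_mulVec, dotProduct_smul, ← mulVec_mulVec, dotProduct_mulVec, vecMul_transpose,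
    dotProduct, smul_eq_mul, Finset.mul_sum]
  refine Finset.sum_congr rfl fun k _ => ?_
  rw [mul_pow, inv_pow, Real.sq_sqrt (Nat.cast_nonneg n)]
  ring

variable {d : ℕ} {X : (n : ℕ) → Matrix (Fin n) (Fin d) ℝ} {Q : Matrix (Fin d) (Fin d) ℝ}

theorem aemeasurable_score (hident : ∀ i, IdentDistrib (ε i) (ε 0) μ μ) (n : ℕ) :
    AEMeasurable (fun ω => score (X n) fun i => ε i ω) μ := by
  have hmeas : ∀ i, AEMeasurable (ε i) μ := fun i => (hident i).aemeasurable_fst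
  have h : AEMeasurable (fun ω (i : Fin n) => ε i ω) μ := aemeasurable_pi_lambda _ fun i => hmeas i
  have hcont : Continuous fun v : Fin n → ℝ => (√(n : ℝ))⁻¹ • ((X n)ᵀ *ᵥ v) := by fun_prop
  exact hcont.measurable.comp_aemeasurable h

theorem tendsto_charFun_score_dotProduct [IsProbabilityMeasure μ] (hindep : iIndepFun ε μ)
    (hident : ∀ i, IdentDistrib (ε i) (ε 0) μ μ) (hL2 : MemLp (ε 0) 2 μ)
    (hmean : ∫ ω, ε 0 ω ∂μ = 0) (hvar : variance (ε 0) μ = σ ^ 2)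
    (hXQ : Tendsto (fun n : ℕ => (n : ℝ)⁻¹ • ((X n)ᵀ * X n)) atTop (𝓝 Q))
    (hXrow : ∀ δ : ℝ, 0 < δ → ∀ᶠ n : ℕ in atTop, ∀ i j, |X n i j| ≤ δ * √n) (u : Fin d → ℝ) :
    Tendsto (fun n => charFun (μ.map fun ω => score (X n) (fun i => ε i ω) ⬝ᵥ u) 1) atTop
      (𝓝 (Complex.exp (-(σ ^ 2 * (u ⬝ᵥ Q *ᵥ u) / 2) : ℝ))) := by
  simp_rw [score_dotProduct]
  refine tendsto_charFun_weighted_sum hindep hident hL2 hmean hvar ?_ fun δ hδ => ?_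
  · simp_rw [sum_sq_inv_sqrt_mul_mulVec]
    have hcont : Continuous fun A : Matrix (Fin d) (Fin d) ℝ => u ⬝ᵥ A *ᵥ u := by fun_prop
    exact (hcont.tendsto Q).comp hXQ
  · have hpos : 0 < ∑ j, |u j| + 1 := by positivity
    filter_upwards [hXrow (δ / (∑ j, |u j| + 1)) (by positivity), eventually_gt_atTop 0]
      with n h hn k
    have hs : 0 < √(n : ℝ) := Real.sqrt_pos.2 (by exact_mod_cast hn)
    have h1 : |(X n *ᵥ u) k| ≤ δ / (∑ j, |u j| + 1) * √n * ∑ j, |u j| := by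
      rw [mulVec, dotProduct, Finset.mul_sum]
      refine (Finset.abs_sum_le_sum_abs _ _).trans (Finset.sum_le_sum fun j _ => ?_)
      rw [abs_mul]
      gcongr
      exact h k j
    rw [abs_mul, abs_of_pos (inv_pos.2 hs)]
    calc (√(n : ℝ))⁻¹ * |(X n *ᵥ u) k|
        ≤ (√(n : ℝ))⁻¹ * (δ / (∑ j, |u j| + 1) * √n * (∑ j, |u j| + 1)) := by
          gcongr
          refine h1.trans ?_
          gcongr
          linarith
      _ = δ := by field_simp

/-- The normalized scores are bounded in probability, by Chebyshev's inequality. -/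
theorem exists_eventually_measure_norm_score_le [IsProbabilityMeasure μ] (hindep : iIndepFun ε μ)
    (hident : ∀ i, IdentDistrib (ε i) (ε 0) μ μ) (hL2 : MemLp (ε 0) 2 μ)
    (hmean : ∫ ω, ε 0 ω ∂μ = 0) (hvar : variance (ε 0) μ = σ ^ 2)
    (hXQ : Tendsto (fun n : ℕ => (n : ℝ)⁻¹ • ((X n)ᵀ * X n)) atTop (𝓝 Q)) {δ : ℝ} (hδ : 0 < δ) :
    ∃ K : ℝ, ∀ᶠ n : ℕ in atTop,
      μ {ω | K < ‖score (X n) fun i => ε i ω‖} ≤ ENNReal.ofReal δ := by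
  have htr : Tendsto (fun n : ℕ => ∑ i, ((n : ℝ)⁻¹ • ((X n)ᵀ * X n)) i i) atTop
      (𝓝 (∑ i, Q i i)) := by
    have hcont : Continuous fun A : Matrix (Fin d) (Fin d) ℝ => ∑ i, A i i := by fun_prop
    exact (hcont.tendsto Q).comp hXQ
  set T := |∑ i, Q i i| + 1 with hT
  set K := σ ^ 2 * T / δ + 1 with hK
  have hK1 : 1 ≤ K := by rw [hK]; linarith [show 0 ≤ σ ^ 2 * T / δ by positivity]
  have hK0 : 0 < K := by linarith
  refine ⟨K, ?_⟩
  filter_upwards [htr.eventually_lt_const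
    (show ∑ i, Q i i < T by rw [hT]; linarith [le_abs_self (∑ i, Q i i)])] with n hn
  have hcoord : ∀ i, μ {ω | K ≤ |score (X n) (fun i => ε i ω) i|} ≤
      ENNReal.ofReal (σ ^ 2 * ((n : ℝ)⁻¹ • ((X n)ᵀ * X n)) i i / K ^ 2) := fun i => by
    have heq : ∀ ω, score (X n) (fun i => ε i ω) i =
        ∑ k, ((√n)⁻¹ * (X n *ᵥ Pi.single i 1) k) * ε k ω := fun ω =>
      (by simp : _ = score (X n) (fun i => ε i ω) ⬝ᵥ Pi.single i 1).trans (score_dotProduct _ _ _)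
    simp_rw [heq]
    have hterm : ∀ k : Fin n,
        MemLp (fun ω => ((√n)⁻¹ * (X n *ᵥ Pi.single i 1) k) * ε k ω) 2 μ :=
      fun k => ((hident k).memLp_iff.2 hL2).const_mul _
    have hch := meas_ge_le_variance_div_sq (memLp_finsetSum Finset.univ fun k _ => hterm k) hK0
    rw [variance_weighted_sum hindep hident hL2 hvar, sum_sq_inv_sqrt_mul_mulVec] at hch
    have hint : ∫ ω, ∑ k, ((√n)⁻¹ * (X n *ᵥ Pi.single i 1) k) * ε k ω ∂μ = 0 := by
      rw [integral_finsetSum _ fun k _ => (hterm k).integrable (by norm_num)]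
      refine Finset.sum_eq_zero fun k _ => ?_
      rw [integral_const_mul, (hident k).integral_eq, hmean, mul_zero]
    rw [hint] at hch
    simpa using hch
  calc μ {ω | K < ‖score (X n) fun i => ε i ω‖}
      ≤ μ (⋃ i, {ω | K ≤ |score (X n) (fun i => ε i ω) i|}) := by
        refine measure_mono fun ω hω => ?_
        by_contra hcon
        simp only [Set.mem_iUnion, Set.mem_ofPred_eq, not_exists, not_le] at hcon
        exact absurd hω (not_lt.2 ((pi_norm_le_iff_of_nonneg hK0.le).2 fun i => (hcon i).le))
    _ ≤ ∑ i, ENNReal.ofReal (σ ^ 2 * ((n : ℝ)⁻¹ • ((X n)ᵀ * X n)) i i / K ^ 2) :=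
        (measure_iUnion_fintype_le _ _).trans (Finset.sum_le_sum fun i _ => hcoord i)
    _ = ENNReal.ofReal (σ ^ 2 * (∑ i, ((n : ℝ)⁻¹ • ((X n)ᵀ * X n)) i i) / K ^ 2) := by
        rw [Finset.mul_sum, Finset.sum_div, ENNReal.ofReal_sum_of_nonneg]
        intro i _
        have : 0 ≤ ((X n)ᵀ * X n) i i := by
          rw [mul_apply]
          exact Finset.sum_nonneg fun k _ => mul_self_nonneg _
        rw [Matrix.smul_apply, smul_eq_mul]
        positivity
    _ ≤ ENNReal.ofReal δ := by
        refine ENNReal.ofReal_le_ofReal ?_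
        rw [div_le_iff₀ (by positivity)]
        calc σ ^ 2 * ∑ i, ((n : ℝ)⁻¹ • ((X n)ᵀ * X n)) i i ≤ σ ^ 2 * T := by gcongr
          _ = δ * (σ ^ 2 * T / δ) := by field_simp
          _ ≤ δ * K := by gcongr; rw [hK]; linarith
          _ ≤ δ * K ^ 2 := by
            gcongr
            nlinarith

end CLT

/-! ### Least squares on the true support -/

/-- The extension by zero of a vector indexed by `J`. -/
def extendZero {d : ℕ} (J : Finset (Fin d)) (v : J → ℝ) : Fin d → ℝ :=
  fun i => if h : i ∈ J then v ⟨i, h⟩ else 0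

/-- The principal submatrix of `Q` on `J`. -/
abbrev principal {d : ℕ} (J : Finset (Fin d)) (Q : Matrix (Fin d) (Fin d) ℝ) : Matrix J J ℝ :=
  Q.submatrix (fun i : J => (i : Fin d)) (fun i : J => (i : Fin d))

/-- The minimizer `Q_JJ⁻¹ z_J` of the limiting quadratic loss over the coordinate subspace of `J`,
as a function of the normalized score `z`. -/
noncomputable def oracle {d : ℕ} (J : Finset (Fin d)) (Q : Matrix (Fin d) (Fin d) ℝ)
    (z : Fin d → ℝ) : J → ℝ :=
  (principal J Q)⁻¹ *ᵥ fun i => z i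

theorem supp_extendZero_subset {d : ℕ} (J : Finset (Fin d)) (v : J → ℝ) :
    supp (extendZero J v) ⊆ J :=
  supp_subset_iff.2 fun i hi => by simp [extendZero, hi]

theorem extendZero_coe {d : ℕ} {J : Finset (Fin d)} (v : J → ℝ) (i : J) :
    extendZero J v i = v i := by
  simp [extendZero]

theorem dotProduct_extendZero {d : ℕ} {J : Finset (Fin d)} (u : Fin d → ℝ) (v : J → ℝ) :
    u ⬝ᵥ extendZero J v = (fun i : J => u i) ⬝ᵥ v := by
  rw [dotProduct, ← Finset.sum_subset (Finset.subset_univ J) fun i _ hi => by simp [extendZero, hi],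
    ← Finset.sum_coe_sort, dotProduct]
  exact Finset.sum_congr rfl fun i _ => by rw [extendZero_coe]

theorem mulVec_extendZero {d : ℕ} {J : Finset (Fin d)} (Q : Matrix (Fin d) (Fin d) ℝ) (v : J → ℝ)
    (i : J) : (Q *ᵥ extendZero J v) i = (principal J Q *ᵥ v) i := by
  rw [mulVec, dotProduct_extendZero]
  rfl

theorem posDef_principal {d : ℕ} (J : Finset (Fin d)) {Q : Matrix (Fin d) (Fin d) ℝ}
    (hQ : Q.PosDef) : (principal J Q).PosDef :=
  hQ.submatrix Subtype.val_injective

theorem principal_mulVec_inv_mulVec {d : ℕ} (J : Finset (Fin d)) {Q : Matrix (Fin d) (Fin d) ℝ}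
    (hQ : Q.PosDef) (v : J → ℝ) : principal J Q *ᵥ ((principal J Q)⁻¹ *ᵥ v) = v := by
  rw [mulVec_mulVec, mul_nonsing_inv _ ((posDef_principal J hQ).det_pos.ne'.isUnit), one_mulVec]

theorem exists_norm_extendZero_oracle_le {d : ℕ} (J : Finset (Fin d))
    (Q : Matrix (Fin d) (Fin d) ℝ) :
    ∃ C : ℝ, 0 ≤ C ∧ ∀ z, ‖extendZero J (oracle J Q z)‖ ≤ C * ‖z‖ := by
  refine ⟨∑ i, ∑ j, |(principal J Q)⁻¹ i j|, by positivity, fun z => ?_⟩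
  refine (pi_norm_le_iff_of_nonneg (by positivity)).2 fun i => ?_
  by_cases hi : i ∈ J
  · rw [extendZero, dif_pos hi, oracle, mulVec, dotProduct, Finset.sum_mul]
    calc ‖∑ j : J, (principal J Q)⁻¹ ⟨i, hi⟩ j * z j‖
        ≤ ∑ j : J, |(principal J Q)⁻¹ ⟨i, hi⟩ j| * ‖z‖ := by
          refine (norm_sum_le _ _).trans (Finset.sum_le_sum fun j _ => ?_)
          rw [norm_mul, Real.norm_eq_abs ((principal J Q)⁻¹ ⟨i, hi⟩ j)]
          gcongr
          exact norm_le_pi_norm z j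
      _ = (fun k : J => (∑ j, |(principal J Q)⁻¹ k j|) * ‖z‖) ⟨i, hi⟩ := by
          simp only [Finset.sum_mul]
      _ ≤ ∑ k : J, (∑ j, |(principal J Q)⁻¹ k j|) * ‖z‖ :=
          Finset.single_le_sum (f := fun k : J => (∑ j, |(principal J Q)⁻¹ k j|) * ‖z‖)
            (fun k _ => by positivity) (Finset.mem_univ _)
  · simp only [extendZero, hi, dite_false, norm_zero]
    positivity

section Limits

variable {Ω : Type*} [MeasurableSpace Ω] {μ : Measure Ω}
  {ε : ℕ → Ω → ℝ} {σ : ℝ} {d : ℕ} {X : (n : ℕ) → Matrix (Fin n) (Fin d) ℝ}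
  {Q : Matrix (Fin d) (Fin d) ℝ}

/-- Asymptotic normality of least squares on `J`: each inner product `⟪Q_JJ⁻¹ z_J, t⟫` is a weighted
sum `z ⬝ᵥ u` of the noise variables, where `u` extends `Q_JJ⁻¹ t` by zero and
`u ⬝ᵥ Q *ᵥ u = t ⬝ᵥ Q_JJ⁻¹ *ᵥ t`. -/
theorem tendstoInDistribution_oracle_score [IsProbabilityMeasure μ]
    (J : Finset (Fin d)) (hQ : Q.PosDef)
    (hXQ : Tendsto (fun n : ℕ => (n : ℝ)⁻¹ • ((X n)ᵀ * X n)) atTop (𝓝 Q))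
    (hXrow : ∀ δ : ℝ, 0 < δ → ∀ᶠ n : ℕ in atTop, ∀ i j, |X n i j| ≤ δ * √n)
    (hindep : iIndepFun ε μ)
    (hident : ∀ i, IdentDistrib (ε i) (ε 0) μ μ) (hL2 : MemLp (ε 0) 2 μ)
    (hmean : ∫ ω, ε 0 ω ∂μ = 0) (hvar : variance (ε 0) μ = σ ^ 2) :
    TendstoInDistribution
      (fun (n : ℕ) (ω : Ω) => WithLp.toLp 2 (oracle J Q (score (X n) fun i => ε i ω)))
      atTop (id : EuclideanSpace ℝ J → _) (fun _ => μ)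
      (multivariateGaussian 0 (σ ^ 2 • (principal J Q)⁻¹)) := by
  set A := (principal J Q)⁻¹ with hA
  have hApd : A.PosDef := (posDef_principal J hQ).inv
  have hAt : Aᵀ = A := by simpa using hApd.1.eq
  have hcont : Continuous fun z : Fin d → ℝ => WithLp.toLp 2 (oracle J Q z) :=
    (PiLp.continuous_toLp 2 fun _ : J => ℝ).comp (by unfold oracle; fun_prop)
  have hmeas : ∀ n, AEMeasurable
      (fun ω => WithLp.toLp 2 (oracle J Q (score (X n) fun i => ε i ω))) μ := fun n =>
    hcont.measurable.comp_aemeasurable (aemeasurable_score hident n)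
  refine ⟨hmeas, aemeasurable_id, ProbabilityMeasure.tendsto_iff_tendsto_charFun.2 fun t => ?_⟩
  set u := extendZero J (A *ᵥ t.ofLp) with hu
  have hinner : ∀ n ω, inner ℝ (WithLp.toLp 2 (oracle J Q (score (X n) fun i => ε i ω))) t =
      score (X n) (fun i => ε i ω) ⬝ᵥ u := fun n ω => by
    rw [hu, dotProduct_extendZero, EuclideanSpace.inner_eq_star_dotProduct, star_trivial, oracle,
      dotProduct_mulVec, ← mulVec_transpose, hAt, dotProduct_comm]
  have hquad : u ⬝ᵥ Q *ᵥ u = t.ofLp ⬝ᵥ A *ᵥ t.ofLp := by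
    rw [dotProduct_comm, hu, dotProduct_extendZero]
    have h : (fun i : J => (Q *ᵥ extendZero J (A *ᵥ t.ofLp)) i) = t.ofLp := by
      ext i
      rw [mulVec_extendZero, hA, principal_mulVec_inv_mulVec J hQ]
    rw [h]
  have hchar : ∀ n, charFun (μ.map fun ω =>
      WithLp.toLp 2 (oracle J Q (score (X n) fun i => ε i ω))) t =
      charFun (μ.map fun ω => score (X n) (fun i => ε i ω) ⬝ᵥ u) 1 := fun n => by
    have hdot : Continuous fun z : Fin d → ℝ => z ⬝ᵥ u := by fun_prop
    have hdot' : AEMeasurable (fun ω => score (X n) (fun i => ε i ω) ⬝ᵥ u) μ :=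
      hdot.measurable.comp_aemeasurable (aemeasurable_score hident n)
    rw [charFun_apply, charFun_apply_real, integral_map (hmeas n) (by fun_prop),
      integral_map hdot' (by fun_prop)]
    simp [hinner]
  have hS : (σ ^ 2 • A).PosSemidef := hApd.posSemidef.smul (sq_nonneg σ)
  have hlim : charFun (multivariateGaussian 0 (σ ^ 2 • A)) t =
      Complex.exp (-(σ ^ 2 * (u ⬝ᵥ Q *ᵥ u) / 2) : ℝ) := by
    rw [charFun_multivariateGaussian hS, hquad, smul_mulVec, dotProduct_smul]
    simp
  have h := tendsto_charFun_score_dotProduct hindep hident hL2 hmean hvar hXQ hXrow u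
  simp only [ProbabilityMeasure.coe_mk, Measure.map_id, hchar, hlim]
  exact h

/-! ### Comparison of the estimator with least squares on the true support -/

variable {Φ : (Fin d → ℝ) → ℝ≥0∞} {α : ℝ} {wstar : Fin d → ℝ} {lam : ℕ → ℝ}
  {w0 what : ℕ → Ω → Fin d → ℝ}

/-- Up to events of arbitrarily small probability, the estimator has the true support, and its
local parameter is close to that of least squares on the true support, which stays bounded. -/
theorem exists_eventually_measure_not_near_oracle_le [IsProbabilityMeasure μ]
    (hΦ : IsMonotonePenalty Φ)
    (hα0 : 0 < α) (hα1 : α < 1)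
    (hdom : (fun i => |wstar i| ^ α) ∈ interior (effDom Φ))
    (hstable : StronglyStable Φ (supp wstar)) (hQ : Q.PosDef)
    (hXQ : Tendsto (fun n : ℕ => (n : ℝ)⁻¹ • ((X n)ᵀ * X n)) atTop (𝓝 Q))
    (hindep : iIndepFun ε μ)
    (hident : ∀ i, IdentDistrib (ε i) (ε 0) μ μ) (hL2 : MemLp (ε 0) 2 μ)
    (hmean : ∫ ω, ε 0 ω ∂μ = 0) (hvar : variance (ε 0) μ = σ ^ 2)
    (hlam : ∀ n, 0 < lam n)
    (hlam0 : Tendsto (fun n : ℕ => lam n / √n) atTop (𝓝 0))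
    (hlamtop : Tendsto (fun n : ℕ => lam n / (n : ℝ) ^ (α / 2)) atTop atTop)
    (hw0c : SqrtConsistent μ w0 wstar)
    (hmin : ∀ n, ∀ᵐ ω ∂μ,
      (∃ w, IsAdaptiveEstimate (X n) (response (X n) wstar (fun i => ε i ω)) (lam n) Φ α
        (w0 n ω) w) →
      IsAdaptiveEstimate (X n) (response (X n) wstar (fun i => ε i ω)) (lam n) Φ α (w0 n ω)
        (what n ω))
    {δ η : ℝ} (hδ : 0 < δ) (hη : 0 < η) :
    ∃ R : ℝ, ∀ᶠ n : ℕ in atTop, μ {ω | ¬ (supp (what n ω) = supp wstar ∧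
      ‖√n • (what n ω - wstar) -
        extendZero (supp wstar) (oracle (supp wstar) Q (score (X n) fun i => ε i ω))‖ ≤ η ∧
      ‖√n • (what n ω - wstar)‖ ≤ R)} ≤ ENNReal.ofReal δ := by
  obtain ⟨K0, hK0⟩ := hw0c (δ / 2) (by positivity)
  obtain ⟨K1, hK1⟩ := exists_eventually_measure_norm_score_le hindep hident hL2 hmean hvar hXQ
    (half_pos hδ)
  obtain ⟨C, hC, hCle⟩ := exists_norm_extendZero_oracle_le (supp wstar) Q
  set K := max (max K0 K1) (max (C * K1) 1) with hK
  have hKpos : 0 < K := lt_of_lt_of_le one_pos ((le_max_right _ _).trans (le_max_right _ _))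
  refine ⟨η + K, ?_⟩
  filter_upwards [hK0, hK1, eventually_isAdaptiveEstimate_near hΦ hα0 hα1 hdom hstable hQ hXQ hlam
    hlam0 hlamtop hKpos hη] with n h0 h1 hdet
  have hsub : {ω | ¬ (supp (what n ω) = supp wstar ∧
      ‖√n • (what n ω - wstar) -
        extendZero (supp wstar) (oracle (supp wstar) Q (score (X n) fun i => ε i ω))‖ ≤ η ∧
      ‖√n • (what n ω - wstar)‖ ≤ η + K)} ⊆
      ({ω | K0 < √n * ‖w0 n ω - wstar‖} ∪ {ω | K1 < ‖score (X n) fun i => ε i ω‖}) ∪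
      {ω | ¬ ((∃ w, IsAdaptiveEstimate (X n) (response (X n) wstar (fun i => ε i ω)) (lam n) Φ α
        (w0 n ω) w) →
      IsAdaptiveEstimate (X n) (response (X n) wstar (fun i => ε i ω)) (lam n) Φ α (w0 n ω)
        (what n ω))} := by
    intro ω hω
    by_contra hcon
    simp only [Set.mem_union, Set.mem_ofPred_eq, not_or, not_lt, not_not] at hcon
    obtain ⟨⟨ha, hb⟩, hc⟩ := hcon
    set z := score (X n) fun i => ε i ω
    have hv0 : ‖extendZero (supp wstar) (oracle (supp wstar) Q z)‖ ≤ K :=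
      ((hCle z).trans (mul_le_mul_of_nonneg_left hb hC)).trans
        ((le_max_left _ _).trans (le_max_right _ _))
    obtain ⟨hex, hall⟩ := hdet (fun i => ε i ω) (w0 n ω)
      (extendZero (supp wstar) (oracle (supp wstar) Q z))
      (ha.trans ((le_max_left _ _).trans (le_max_left _ _)))
      (hb.trans ((le_max_right _ _).trans (le_max_left _ _))) hv0
      (supp_extendZero_subset _ _) fun i hi => by
        have := mulVec_extendZero Q (oracle (supp wstar) Q z) ⟨i, hi⟩
        rw [oracle, principal_mulVec_inv_mulVec _ hQ] at this
        exact this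
    obtain ⟨hs, hn⟩ := hall _ (hc hex)
    refine hω ⟨hs, hn, ?_⟩
    calc ‖√(n : ℝ) • (what n ω - wstar)‖
        = ‖(√(n : ℝ) • (what n ω - wstar) - extendZero (supp wstar) (oracle (supp wstar) Q z)) +
          extendZero (supp wstar) (oracle (supp wstar) Q z)‖ := by rw [sub_add_cancel]
      _ ≤ η + K := (norm_add_le _ _).trans (add_le_add hn hv0)
  calc _ ≤ _ := measure_mono hsub
    _ ≤ (ENNReal.ofReal (δ / 2) + ENNReal.ofReal (δ / 2)) + 0 := by
        refine (measure_union_le _ _).trans (add_le_add ?_ (le_of_eq (ae_iff.1 (hmin n))))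
        exact (measure_union_le _ _).trans (add_le_add h0 h1)
    _ = ENNReal.ofReal δ := by
        rw [add_zero, ← ENNReal.ofReal_add (by positivity) (by positivity), add_halves]

theorem tendsto_measure_zero_of_forall_eventually_le {s : ℕ → Set Ω}
    (h : ∀ δ : ℝ, 0 < δ → ∀ᶠ n in atTop, μ (s n) ≤ ENNReal.ofReal δ) :
    Tendsto (fun n => μ (s n)) atTop (𝓝 0) := by
  refine ENNReal.tendsto_nhds_zero.2 fun r hr => ?_
  rcases eq_or_ne r ∞ with rfl | hr'
  · simp
  · simpa [ENNReal.ofReal_toReal hr'] using h r.toReal (ENNReal.toReal_pos hr.ne' hr')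

end Limits

end AdaptiveEstimation

theorem mainTheorem1 {d : ℕ}
    -- the penalty
    (Φ : (Fin d → ℝ) → ℝ≥0∞) (hΦ : AdaptiveEstimation.IsMonotonePenalty Φ)
    (α : ℝ) (hα0 : 0 < α) (hα1 : α < 1)
    -- the true vector
    (wstar : Fin d → ℝ)
    (hdom : (fun i => |wstar i| ^ α) ∈ interior (AdaptiveEstimation.effDom Φ))
    (hstable : AdaptiveEstimation.StronglyStable Φ (AdaptiveEstimation.supp wstar))
    -- the fixed designs
    (X : (n : ℕ) → Matrix (Fin n) (Fin d) ℝ) (Q : Matrix (Fin d) (Fin d) ℝ) (hQ : Q.PosDef)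
    (hXQ : Tendsto (fun n : ℕ => (n : ℝ)⁻¹ • ((X n).transpose * X n)) atTop (𝓝 Q))
    (hXrow : ∀ δ : ℝ, 0 < δ → ∀ᶠ n : ℕ in atTop, ∀ i j, |X n i j| ≤ δ * √n)
    -- the noise
    {Ω : Type*} [MeasurableSpace Ω] (μ : Measure Ω) [IsProbabilityMeasure μ]
    (ε : ℕ → Ω → ℝ) (σ : ℝ) (hindep : iIndepFun ε μ)
    (hident : ∀ i, IdentDistrib (ε i) (ε 0) μ μ) (hL2 : MemLp (ε 0) 2 μ)
    (hmean : ∫ ω, ε 0 ω ∂μ = 0) (hvar : variance (ε 0) μ = σ ^ 2)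
    -- the regularization parameters
    (lam : ℕ → ℝ) (hlam : ∀ n, 0 < lam n)
    (hlam0 : Tendsto (fun n : ℕ => lam n / √n) atTop (𝓝 0))
    (hlamtop : Tendsto (fun n : ℕ => lam n / (n : ℝ) ^ (α / 2)) atTop atTop)
    -- the initial estimator
    (w0 : ℕ → Ω → Fin d → ℝ) (hw0 : ∀ n, AEMeasurable (w0 n) μ)
    (hw0c : AdaptiveEstimation.SqrtConsistent μ w0 wstar)
    -- the one-step adaptive estimator: a minimizer, whenever there is one
    (what : ℕ → Ω → Fin d → ℝ) (hwhat : ∀ n, AEMeasurable (what n) μ)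
    (hmin : ∀ n, ∀ᵐ ω ∂μ,
      (∃ w, AdaptiveEstimation.IsAdaptiveEstimate (X n)
        (AdaptiveEstimation.response (X n) wstar (fun i => ε i ω)) (lam n) Φ α (w0 n ω) w) →
      AdaptiveEstimation.IsAdaptiveEstimate (X n)
        (AdaptiveEstimation.response (X n) wstar (fun i => ε i ω)) (lam n) Φ α (w0 n ω)
        (what n ω)) :
    -- consistency
    TendstoInMeasure μ what atTop (fun _ => wstar) ∧
    -- asymptotic normality on the true support
    TendstoInDistribution
      (fun (n : ℕ) (ω : Ω) => WithLp.toLp 2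
        (fun i : AdaptiveEstimation.supp wstar => √n * (what n ω i - wstar i)))
      atTop (id : EuclideanSpace ℝ (AdaptiveEstimation.supp wstar) → _) (fun _ => μ)
      (multivariateGaussian 0
        (σ ^ 2 • (Q.submatrix (fun i : AdaptiveEstimation.supp wstar => (i : Fin d))
          (fun i : AdaptiveEstimation.supp wstar => (i : Fin d)))⁻¹)) ∧
    -- support recovery
    Tendsto (fun n => μ {ω | AdaptiveEstimation.supp (what n ω) = AdaptiveEstimation.supp wstar})
      atTop (𝓝 1) := by
  set J := AdaptiveEstimation.supp wstar with hJ
  have hbad := fun {δ η : ℝ} (hδ : 0 < δ) (hη : 0 < η) =>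
    AdaptiveEstimation.exists_eventually_measure_not_near_oracle_le hΦ hα0 hα1 hdom hstable hQ hXQ
      hindep hident hL2 hmean hvar hlam hlam0 hlamtop hw0c hmin hδ hη
  have hsqrt : Tendsto (fun n : ℕ => √(n : ℝ)) atTop atTop :=
    Real.tendsto_sqrt_atTop.comp tendsto_natCast_atTop_atTop
  refine ⟨?_, ?_, ?_⟩
  · refine tendstoInMeasure_iff_norm.2 fun r hr =>
      AdaptiveEstimation.tendsto_measure_zero_of_forall_eventually_le fun δ hδ => ?_
    obtain ⟨R, hR⟩ := hbad hδ one_pos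
    filter_upwards [hR, hsqrt.eventually_gt_atTop (R / r), hsqrt.eventually_gt_atTop 0]
      with n h1 h2 h3
    refine (measure_mono fun ω hω hgood => ?_).trans h1
    have h4 := hgood.2.2
    rw [norm_smul, Real.norm_of_nonneg h3.le] at h4
    have h5 : √(n : ℝ) * r ≤ √(n : ℝ) * ‖what n ω - wstar‖ := by
      gcongr
      exact hω
    rw [div_lt_iff₀ hr] at h2
    linarith
  · have hmeas : ∀ n : ℕ, AEMeasurable (fun ω => WithLp.toLp 2
        (fun i : J => √(n : ℝ) * (what n ω i - wstar i))) μ := fun n => by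
      have hcont : Continuous fun w : Fin d → ℝ => WithLp.toLp 2
          (fun i : J => √(n : ℝ) * (w i - wstar i)) :=
        (PiLp.continuous_toLp 2 fun _ : J => ℝ).comp (by fun_prop)
      exact hcont.measurable.comp_aemeasurable (hwhat n)
    refine tendstoInDistribution_of_tendstoInMeasure_sub _ _
      (AdaptiveEstimation.tendstoInDistribution_oracle_score J hQ hXQ hXrow hindep hident hL2
        hmean hvar) ?_ hmeas
    refine tendstoInMeasure_iff_norm.2 fun r hr =>
      AdaptiveEstimation.tendsto_measure_zero_of_forall_eventually_le fun δ hδ => ?_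
    -- The Euclidean norm on `J` is at most the number of coordinates times the sup norm.
    have hη : 0 < r / (J.card + 1) := by positivity
    obtain ⟨R, hR⟩ := hbad hδ hη
    filter_upwards [hR] with n h1
    refine (measure_mono fun ω hω hgood => ?_).trans h1
    have h2 := hgood.2.1
    set v := √(n : ℝ) • (what n ω - wstar) - AdaptiveEstimation.extendZero J
      (AdaptiveEstimation.oracle J Q (AdaptiveEstimation.score (X n) fun i => ε i ω)) with hv
    have hlt : ‖WithLp.toLp 2 (fun i : J => v i)‖ < r := by
      have hsum : WithLp.toLp 2 (fun i : J => v i) =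
          ∑ i : J, v i • EuclideanSpace.single i (1 : ℝ) := by
        ext j
        simp [Pi.single_apply]
      rw [hsum]
      calc ‖∑ i : J, v i • EuclideanSpace.single i (1 : ℝ)‖
          ≤ ∑ _i : J, r / (J.card + 1) := by
            refine (norm_sum_le _ _).trans (Finset.sum_le_sum fun i _ => ?_)
            rw [norm_smul, PiLp.norm_single, norm_one, mul_one]
            exact (norm_le_pi_norm v i).trans h2
        _ = J.card * (r / (J.card + 1)) := by simp
        _ < r := by
            rw [mul_div_assoc', div_lt_iff₀ (by positivity)]
            nlinarith
    refine absurd hlt (not_lt.2 (le_trans (Set.mem_ofPred_eq ▸ hω) (le_of_eq ?_)))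
    congr 1
    ext i
    simp [hv, AdaptiveEstimation.extendZero_coe]
  · have h0 : Tendsto (fun n => μ {ω | AdaptiveEstimation.supp (what n ω) = J}ᶜ) atTop (𝓝 0) :=
      AdaptiveEstimation.tendsto_measure_zero_of_forall_eventually_le fun δ hδ => by
        obtain ⟨R, hR⟩ := hbad hδ one_pos
        filter_upwards [hR] with n h1
        refine (measure_mono fun ω hω hgood => ?_).trans h1
        exact (Set.mem_compl_iff _ _).1 hω hgood.1
    have h1 : Tendsto (fun n => 1 - μ {ω | AdaptiveEstimation.supp (what n ω) = J}ᶜ) atTop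
        (𝓝 1) := by
      simpa using ENNReal.Tendsto.sub tendsto_const_nhds h0 (Or.inl ENNReal.one_ne_top)
    refine tendsto_of_tendsto_of_tendsto_of_le_of_le h1 tendsto_const_nhds (fun n => ?_)
      fun n => prob_le_one
    rw [tsub_le_iff_right, ← measure_univ (μ := μ),
      ← Set.union_compl_self {ω | AdaptiveEstimation.supp (what n ω) = J}]
    exact measure_union_le _ _
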